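/- Let $Y_1,Y_2,\dots$ be i.i.d. real random variables whose distribution function $F$ is continuous and satisfies, for all large $y$, $1-F(y)=e^{-L(y)y^\rho}$ with $\rho>1$, where $L$ is slowly varying ($L(ty)/L(y)\to1$ as $y\to\infty$ for every $t>0$), twice differentiable for all large $y$, and $yL'(y)/L(y)\to0$, $\bigl(yL'(y)/L(y)\bigr)'\to0$ as $y\to\infty$. Write $F^{-1}(p)=\inf\{x: F(x)\ge p\}$, $U(t)=F^{-1}(1-1/t)$ for $t>1$, and $a(t)=U(et)-U(t)$ (the usual scale of the Gumbel domain of attraction). For $k\ge2$ let $\zeta(1;k-1)=\sum_{j=1}^{k-1}1/j$, let $\gamma$ be Euler's constant, and put $$\alpha_1=\dots=\alpha_{k-1}=\frac{\zeta(1;k-1)-\gamma}{k-1},\qquad \alpha_k=1-(k-1)\alpha_1,\qquad \Omega_k(y)=\sum_{i=1}^k\alpha_i y_i\ \ (y\in\mathbb R^k),\qquad \sigma_k=\frac{\zeta(1;k-1)-\gamma}{\sqrt{k-1}} .$$ Let $\Lambda^{(k)}$ be the law on $\mathbb R^k$ with density $\mathbf 1_{g_1>\dots>g_k}\exp\bigl(-e^{-g_k}-\sum_{i=1}^k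 g_i\bigr)$, and let $\Omega_{k,n}=\Omega_k(Y_{1,n},\dots,Y_{k,n})$, where $Y_{1,n}\ge\dots\ge Y_{n,n}$ are $Y_1,\dots,Y_n$ in decreasing order. Then $\Omega_k$ is asymptotically normal, in the following senses. (1) If, for each $k$, $G^{(k)}$ is a random vector with law $\Lambda^{(k)}$, then $\Omega_k(G^{(k)})/\sigma_k\to\mathcal N(0,1)$ in distribution as $k\to\infty$. (2) For every sequence $k=k(n)$ of natural numbers with $k\to\infty$ and $k/n\to0$ as $n\to\infty$, there are real numbers $c_n$ such that $$\frac{\Omega_{k,n}-c_n}{a(n/k)\,\sigma_k}\longrightarrow\mathcal N(0,1)\quad\text{in distribution as } n\to\infty .$$ (3) There is a sequence $\kappa(n)$ of natural numbers with $\kappa(n)\to\infty$ and $\kappa(n)/n\to0$ such that for every sequence $k=k(n)$ with $k\to\infty$ and $k(n)\le\kappa(n)$ for all large $n$, $$\frac{\Omega_{k,n}-F^{-1}(1-1/n)}{a(n)\,\sigma_k}\longrightarrow\mathcal N(0,1)\quad\text{in distribution as } n\to\infty .$$ -/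

import Mathlib

open MeasureTheory ProbabilityTheory Filter Topology

/-- The class of laws of `Y` (the log-exponential-power class for `X = exp Y`): the distribution
function is continuous and `1 - F(y) = exp (-h(y))` with `h(y) = L(y) * y ^ ρ`, `ρ > 1`, where `L` is
slowly varying, twice differentiable, `y L'(y) / L(y) → 0` and `(y L'(y) / L(y))' → 0` as `y → ∞`.
Only the behaviour of `L` for large `y` matters. -/
structure IsLogExpPowerLaw (μ : Measure ℝ) (ρ : ℝ) : Prop where
  continuous_cdf : Continuous (cdf μ)
  one_lt : 1 < ρ
  exists_slowlyVarying : ∃ L : ℝ → ℝ,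
    (∀ᶠ y in atTop, 1 - cdf μ y = Real.exp (-(L y * y ^ ρ))) ∧
    (∀ t : ℝ, 0 < t → Tendsto (fun y => L (t * y) / L y) atTop (𝓝 1)) ∧
    (∀ᶠ y in atTop, DifferentiableAt ℝ L y ∧ DifferentiableAt ℝ (deriv L) y) ∧
    Tendsto (fun y => y * (deriv L y / L y)) atTop (𝓝 0) ∧
    Tendsto (deriv fun y => y * (deriv L y / L y)) atTop (𝓝 0)

/-- The generalized inverse `F⁻¹(p) = inf {x | p ≤ F(x)}` of the distribution function of `μ`. -/
noncomputable def quantile (μ : Measure ℝ) (p : ℝ) : ℝ :=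
  sInf {x : ℝ | p ≤ cdf μ x}

/-- The tail quantile `U(t) = F⁻¹(1 - 1/t)`, for `t > 1`. -/
noncomputable def tailQuantile (μ : Measure ℝ) (t : ℝ) : ℝ :=
  quantile μ (1 - 1 / t)

/-- The usual scale `a(t) = U(e t) - U(t)` of the Gumbel domain of attraction. -/
noncomputable def gumbelScale (μ : Measure ℝ) (t : ℝ) : ℝ :=
  tailQuantile μ (Real.exp 1 * t) - tailQuantile μ t

/-- `descOrderStat x i` is the `(i + 1)`-th largest value of the sample `x`
(so `i = 0` gives the maximum); it is `0` if the sample has at most `i` elements. -/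
noncomputable def descOrderStat {n : ℕ} (x : Fin n → ℝ) (i : ℕ) : ℝ :=
  if h : i < n then x (Tuple.sort x (Fin.rev ⟨i, h⟩)) else 0

/-- `ζ(1; k - 1) - γ`, where `ζ(1; m) = 1 + 1/2 + ⋯ + 1/m` and `γ` is Euler's constant. -/
noncomputable def zetaGap (k : ℕ) : ℝ :=
  (harmonic (k - 1) : ℝ) - Real.eulerMascheroniConstant

/-- The weights `α₁ = ⋯ = α_{k-1} = (ζ(1; k - 1) - γ) / (k - 1)` and `α_k = 1 - (k - 1) α₁`. -/
noncomputable def omegaWeight (k : ℕ) (i : Fin k) : ℝ :=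
  if (i : ℕ) + 1 = k then 1 - ((k : ℝ) - 1) * (zetaGap k / ((k : ℝ) - 1))
  else zetaGap k / ((k : ℝ) - 1)

/-- The linear combination `Ω_k = ∑ α_i y_i` of a decreasingly ordered vector `y`. -/
noncomputable def omegaStat (k : ℕ) (y : Fin k → ℝ) : ℝ :=
  ∑ i, omegaWeight k i * y i

/-- `Ω_k` applied to the `k` largest values of the first `n` observations. -/
noncomputable def omegaSample {Ω : Type*} (Y : ℕ → Ω → ℝ) (n k : ℕ) (ω : Ω) : ℝ :=
  omegaStat k fun i => descOrderStat (fun j : Fin n => Y j ω) i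

/-- The normalization `(ζ(1; k - 1) - γ) / √(k - 1)`. -/
noncomputable def omegaScale (k : ℕ) : ℝ :=
  zetaGap k / √((k : ℝ) - 1)

/-- The law `Λ^(k)` on `ℝ^k` with density `1_{g₁ > ⋯ > g_k} exp (-exp (-g_k) - ∑ g_i)`
(for `k = 0`, the unit mass on the one-point space). -/
noncomputable def gumbelTopLaw : (k : ℕ) → Measure (Fin k → ℝ)
  | 0 => Measure.dirac 0
  | m + 1 => volume.withDensity <| Set.indicator {g | StrictAnti g} fun g =>
      ENNReal.ofReal (Real.exp (-Real.exp (-g (Fin.last m)) - ∑ i, g i))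

/-! The weights sum to one and all but the last agree, so `Ω_k` is the `k`-th largest value plus
`zetaGap k / (k - 1)` times the sum of the excesses over it (`omegaStat_succ`). The excess sum
carries the Gaussian fluctuation. The lowest value itself fluctuates less by a factor `zetaGap k ~
log k`.

Under `Λ^(k)` the excess sum is a sum of `k - 1` independent standard exponentials, and `exp (-g_k)`
has a Gamma law of shape `k` (`lintegral_gumbelTopLaw`). Hence `g_k = -log k + O(1/√k)` in
probability. This centring cancels the mean `zetaGap k` of the weighted excess sum up to a
negligible term, and the central limit theorem for exponentials finishes.

For the sample, put `t = log (n/k)`, `u = U(n/k)`, `a = a(n/k)`. The cumulative hazard `h` of an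
observation above `u` exceeds `t` by a standard exponential variable (`restrict_Ioi_logQuantile`),
and `y h'(y) / h(y) → ρ > 1` makes the quantile nearly affine in `t`, with a linear bound over all
positive increments (`abs_logQuantile_sub_le`, `logQuantile_sub_le`). So the excess of `y` over `u`
is `a (h(y) - t)` up to an error that is small in mean square. Replacing the random threshold `T =
Y_{k,n}` by `u` changes the excess sum by `-k (T - u)` up to a product of two fluctuations
(`abs_sum_max_sub_le`). The Bahadur representation says that this cancels the fluctuation `a (N -
k)` of the number `N` of exceedances. Only the centred exponential excesses remain
(`abs_omegaSample_sub_le`), and their characteristic function is computed directly.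

To centre at `F⁻¹(1 - 1/n)`, fix `k` first: the standardized change of centring tends to `omegaBias
k`, which vanishes as `k → ∞`. A diagonal argument (`exists_slow_sequence`) lets `k` grow slowly
with `n`. -/

/-! ### Slutsky and Chebyshev. -/

/-- Slutsky's theorem through characteristic functions, on varying probability spaces. -/
theorem tendstoInDistribution_gaussian_of_charFun {Ω : ℕ → Type*} [∀ n, MeasurableSpace (Ω n)]
    (P : ∀ n, Measure (Ω n)) [∀ n, IsProbabilityMeasure (P n)] (X A : ∀ n, Ω n → ℝ)
    (hX : ∀ n, AEMeasurable (X n) (P n)) (hA : ∀ n, AEMeasurable (A n) (P n))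
    (hB : ∀ ε > 0, Tendsto (fun n => (P n).real {ω | ε ≤ |X n ω - A n ω|}) atTop (𝓝 0))
    (hc : ∀ θ : ℝ, Tendsto (fun n => charFun ((P n).map (A n)) θ) atTop
      (𝓝 (Complex.exp (-θ ^ 2 / 2)))) :
    TendstoInDistribution X atTop id P (gaussianReal 0 1) := by
  refine ⟨hX, aemeasurable_id, ProbabilityMeasure.tendsto_iff_tendsto_charFun.2 fun θ => ?_⟩
  have key : ∀ n, ∀ ε > 0, ‖charFun ((P n).map (X n)) θ - charFun ((P n).map (A n)) θ‖ ≤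
      |θ| * ε + 2 * (P n).real {ω | ε ≤ |X n ω - A n ω|} := by
    intro n ε hε
    have hcont : Continuous (fun x : ℝ => Complex.exp (θ * x * Complex.I)) := by fun_prop
    rw [charFun_apply_real, charFun_apply_real,
      integral_map (hX n) hcont.aestronglyMeasurable,
      integral_map (hA n) hcont.aestronglyMeasurable]
    have hn : ∀ x : ℝ, ‖Complex.exp (θ * x * Complex.I)‖ = 1 := fun x => by
      rw [← Complex.ofReal_mul, Complex.norm_exp_ofReal_mul_I]
    have hi : ∀ Z : Ω n → ℝ, AEMeasurable Z (P n) →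
        Integrable (fun ω => Complex.exp (θ * Z ω * Complex.I)) (P n) := fun Z hZ =>
      Integrable.of_bound (hcont.measurable.comp_aemeasurable hZ).aestronglyMeasurable 1
        (Eventually.of_forall fun ω => (hn _).le)
    rw [← integral_sub (hi _ (hX n)) (hi _ (hA n))]
    -- `X` and `A` are only almost everywhere measurable, so the exceptional set is replaced by a
    -- measurable hull of the same measure.
    set S := toMeasurable (P n) {ω | ε ≤ |X n ω - A n ω|} with hS
    have hSm : MeasurableSet S := measurableSet_toMeasurable _ _
    have hSr : (P n).real S = (P n).real {ω | ε ≤ |X n ω - A n ω|} := by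
      simp [Measure.real, hS, measure_toMeasurable]
    have hbound : ∀ ω, ‖Complex.exp (θ * X n ω * Complex.I) - Complex.exp (θ * A n ω * Complex.I)‖
        ≤ |θ| * ε + S.indicator (fun _ => 2) ω := by
      intro ω
      by_cases h : ω ∈ S
      · rw [Set.indicator_of_mem h]
        refine (norm_sub_le _ _).trans ?_
        rw [hn, hn]
        have : 0 ≤ |θ| * ε := by positivity
        linarith
      · rw [Set.indicator_of_notMem h, add_zero]
        have h' : |X n ω - A n ω| < ε := by
          by_contra hcon
          exact h (subset_toMeasurable _ _ (not_lt.1 hcon))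
        have e1 : Complex.exp (θ * X n ω * Complex.I) - Complex.exp (θ * A n ω * Complex.I) =
            Complex.exp (θ * A n ω * Complex.I) *
              (Complex.exp (Complex.I * ((θ * (X n ω - A n ω) : ℝ) : ℂ)) - 1) := by
          rw [mul_sub, ← Complex.exp_add, mul_one]
          congr 2
          push_cast; ring
        rw [e1, norm_mul, hn, one_mul]
        refine (Real.norm_exp_I_mul_ofReal_sub_one_le).trans ?_
        rw [Real.norm_eq_abs, abs_mul]
        gcongr
    have hind : Integrable (fun ω => |θ| * ε + S.indicator (fun _ => (2:ℝ)) ω) (P n) :=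
      (integrable_const _).add ((integrable_const _).indicator hSm)
    refine (norm_integral_le_of_norm_le hind (Eventually.of_forall hbound)).trans ?_
    rw [integral_add (integrable_const _) ((integrable_const _).indicator hSm),
      integral_indicator_const _ hSm, integral_const, hSr]
    simp [mul_comm]
  have hdiff : Tendsto (fun n => charFun ((P n).map (X n)) θ - charFun ((P n).map (A n)) θ) atTop
      (𝓝 0) := by
    rw [Metric.tendsto_atTop]
    intro η hη
    have hε : 0 < η / (2 * (|θ| + 1)) := by positivity
    have h2 := (hB _ hε).eventually (gt_mem_nhds (show (0:ℝ) < η / 4 by positivity))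
    obtain ⟨N, hN⟩ := eventually_atTop.1 h2
    refine ⟨N, fun n hn => ?_⟩
    rw [dist_zero_right]
    have := key n _ hε
    have h3 := hN n hn
    have h4 : |θ| * (η / (2 * (|θ| + 1))) ≤ η / 2 := by
      rw [mul_div_assoc', div_le_div_iff₀ (by positivity) (by positivity)]
      nlinarith [abs_nonneg θ]
    linarith
  have := hdiff.add (hc θ)
  simp only [sub_add_cancel, zero_add] at this
  simpa [charFun_gaussianReal, neg_div] using this

/-- Chebyshev's inequality for a sum of functions of an i.i.d. sample. -/
theorem measureReal_sum_ge_le {Ω : Type*} [MeasurableSpace Ω] {P : Measure Ω}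
    [IsProbabilityMeasure P] {Y : ℕ → Ω → ℝ} {μ : Measure ℝ} [IsProbabilityMeasure μ]
    (hlaw : ∀ i, HasLaw (Y i) μ P) (hindep : iIndepFun Y P) {g : ℝ → ℝ} (hg : Measurable g)
    (hg2 : MemLp g 2 μ) (n : ℕ) {c : ℝ} (hc : 0 < c) :
    P.real {ω | c ≤ |∑ i : Fin n, g (Y i ω) - n * ∫ y, g y ∂μ|} ≤ n * (∫ y, g y ^ 2 ∂μ) / c ^ 2 := by
  have hcomp : ∀ i, HasLaw (fun ω => g (Y i ω)) (μ.map g) P := fun i =>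
    ⟨hg.comp_aemeasurable (hlaw i).aemeasurable, by
      rw [← (hlaw i).map_eq, AEMeasurable.map_map_of_aemeasurable hg.aemeasurable
        (hlaw i).aemeasurable]; rfl⟩
  have hid : MemLp id 2 (μ.map g) := by
    rw [memLp_map_measure_iff (by fun_prop) hg.aemeasurable]; exact hg2
  have hL : ∀ i : Fin n, MemLp (fun ω => g (Y i ω)) 2 P := fun i => by
    have := hid
    rw [← (hcomp i).map_eq, memLp_map_measure_iff (by fun_prop) (hcomp i).aemeasurable] at this
    exact this
  have hE : ∀ i : Fin n, ∫ ω, g (Y i ω) ∂P = ∫ y, g y ∂μ := fun i =>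
    (hlaw i).integral_comp hg.aestronglyMeasurable
  have hE2 : ∀ i : Fin n, ∫ ω, g (Y i ω) ^ 2 ∂P = ∫ y, g y ^ 2 ∂μ := fun i =>
    (hlaw i).integral_comp (f := fun y => g y ^ 2) (by fun_prop)
  have hsumE : ∫ ω, (∑ i : Fin n, fun ω => g (Y i ω)) ω ∂P = n * ∫ y, g y ∂μ := by
    simp only [Finset.sum_apply]
    rw [integral_finsetSum _ fun i _ => (hL i).integrable (by simp)]
    simp [hE]
  have hvar : variance (∑ i : Fin n, fun ω => g (Y i ω)) P ≤ n * ∫ y, g y ^ 2 ∂μ := by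
    rw [IndepFun.variance_sum (fun i _ => hL i)]
    · calc ∑ i : Fin n, variance (fun ω => g (Y i ω)) P ≤ ∑ _i : Fin n, ∫ y, g y ^ 2 ∂μ := by
            refine Finset.sum_le_sum fun i _ => ?_
            rw [← hE2 i]
            exact variance_le_expectation_sq (hL i).aestronglyMeasurable
        _ = n * ∫ y, g y ^ 2 ∂μ := by simp
    · intro i _ j _ hij
      exact (hindep.indepFun (fun h => hij (Fin.ext h))).comp hg hg
  have hch := meas_ge_le_variance_div_sq (memLp_finsetSum' Finset.univ fun i _ => hL i) hc
  rw [hsumE] at hch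
  simp only [Finset.sum_apply] at hch
  refine (ENNReal.toReal_mono ENNReal.ofReal_ne_top hch).trans ?_
  rw [ENNReal.toReal_ofReal (div_nonneg (variance_nonneg _ _) (sq_nonneg _))]
  gcongr

/-! ### Order statistics, exceedance counts and sums of excesses. -/

theorem omegaStat_succ {m : ℕ} (hm : 1 ≤ m) (y : Fin (m + 1) → ℝ) :
    omegaStat (m + 1) y = y (Fin.last m) +
      zetaGap (m + 1) / m * ∑ i : Fin m, (y i.castSucc - y (Fin.last m)) := by
  have hm' : (m : ℝ) ≠ 0 := by positivity
  unfold omegaStat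
  rw [Fin.sum_univ_castSucc]
  have h1 : ∀ i : Fin m, omegaWeight (m + 1) i.castSucc = zetaGap (m + 1) / m := fun i => by
    have : (i : ℕ) ≠ m := i.2.ne
    simp [omegaWeight, this]
  have h2 : omegaWeight (m + 1) (Fin.last m) = 1 - m * (zetaGap (m + 1) / m) := by
    simp [omegaWeight]
  simp only [h1, h2]
  rw [Finset.sum_sub_distrib, ← Finset.mul_sum]
  simp
  ring

theorem descOrderStat_of_lt {n : ℕ} (x : Fin n → ℝ) (i : Fin n) :
    descOrderStat x i = x (Tuple.sort x (Fin.rev i)) := by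
  simp [descOrderStat]

theorem descOrderStat_antitone {n : ℕ} (x : Fin n → ℝ) {i j : Fin n} (h : i ≤ j) :
    descOrderStat x j ≤ descOrderStat x i := by
  rw [descOrderStat_of_lt, descOrderStat_of_lt]
  exact Tuple.monotone_sort x (Fin.rev_le_rev.2 h)

theorem sum_descOrderStat {n : ℕ} (x : Fin n → ℝ) (f : ℝ → ℝ) :
    ∑ i : Fin n, f (descOrderStat x i) = ∑ i, f (x i) := by
  simp only [descOrderStat_of_lt]
  exact Equiv.sum_comp (Fin.revPerm.trans (Tuple.sort x)) fun i => f (x i)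

theorem card_filter_descOrderStat {n : ℕ} (x : Fin n → ℝ) (p : ℝ → Prop) [DecidablePred p] :
    (Finset.univ.filter fun i : Fin n => p (descOrderStat x i)).card =
      (Finset.univ.filter fun i => p (x i)).card := by
  have := sum_descOrderStat x fun y => if p y then 1 else 0
  simp only [Finset.sum_boole] at this
  exact_mod_cast this

/-- Duality between order statistics and exceedance counts. It gives measurability of order
statistics and turns their fluctuations into those of binomial counts. -/
theorem lt_descOrderStat_iff {n : ℕ} (x : Fin n → ℝ) (i : Fin n) (v : ℝ) :
    v < descOrderStat x i ↔ (i : ℕ) + 1 ≤ (Finset.univ.filter fun j => v < x j).card := by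
  rw [← card_filter_descOrderStat x (fun y => v < y)]
  constructor
  · intro h
    rw [← Fin.card_Iic]
    refine Finset.card_le_card fun j hj => ?_
    simp only [Finset.mem_filter, Finset.mem_univ, true_and]
    exact h.trans_le (descOrderStat_antitone x (Finset.mem_Iic.1 hj))
  · intro h
    by_contra hv
    have : (Finset.univ.filter fun j : Fin n => v < descOrderStat x j).card ≤
        (Finset.Iio i).card := by
      refine Finset.card_le_card fun j hj => ?_
      simp only [Finset.mem_filter, Finset.mem_univ, true_and] at hj
      rw [Finset.mem_Iio]
      by_contra hij
      exact hv (hj.trans_le (descOrderStat_antitone x (not_lt.1 hij)))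
    rw [Fin.card_Iio] at this
    omega

theorem card_ge_descOrderStat {n : ℕ} (x : Fin n → ℝ) (i : Fin n) :
    (i : ℕ) + 1 ≤ (Finset.univ.filter fun j => descOrderStat x i ≤ x j).card := by
  rw [← card_filter_descOrderStat x (fun y => descOrderStat x i ≤ y), ← Fin.card_Iic]
  refine Finset.card_le_card fun j hj => ?_
  simp only [Finset.mem_filter, Finset.mem_univ, true_and]
  exact descOrderStat_antitone x (Finset.mem_Iic.1 hj)

/-- Positive parts vanish below the threshold, so the sum over the top values extends to the whole
unordered sample; at a fixed threshold it is then a sum of i.i.d. terms. -/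
theorem omegaStat_descOrderStat {n m : ℕ} (hm : 1 ≤ m) (hmn : m < n) (x : Fin n → ℝ) :
    omegaStat (m + 1) (fun i => descOrderStat x i) = descOrderStat x m +
      zetaGap (m + 1) / m * ∑ j, max (x j - descOrderStat x m) 0 := by
  rw [omegaStat_succ hm]
  simp only [Fin.val_last, Fin.val_castSucc]
  congr 2
  rw [← sum_descOrderStat x fun y => max (y - descOrderStat x m) 0,
    Fin.sum_univ_eq_sum_range (fun i => descOrderStat x i - descOrderStat x m),
    Fin.sum_univ_eq_sum_range (fun i => max (descOrderStat x i - descOrderStat x m) 0)]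
  rw [← Finset.sum_subset (Finset.range_subset_range.2 hmn.le)]
  · refine Finset.sum_congr rfl fun i hi => ?_
    have hi' := Finset.mem_range.1 hi
    rw [max_eq_left]
    exact sub_nonneg.2 (descOrderStat_antitone x (i := ⟨i, hi'.trans hmn⟩) (j := ⟨m, hmn⟩) hi'.le)
  · intro i hi hi'
    rw [Finset.mem_range] at hi hi'
    rw [max_eq_right]
    exact sub_nonpos.2 (descOrderStat_antitone x (i := ⟨m, hmn⟩) (j := ⟨i, hi⟩) (not_lt.1 hi'))

/-- As a function of the threshold, the sum of excesses is convex and piecewise linear, with slope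
minus the number of points above. Between `u` and the order statistic `T` this number lies between
the count at `u` and `m + 1`; at `T`, with ties allowed, at least `m + 1` points are `≥ T` and at
most `m + 1` are `> T`. -/
theorem abs_sum_max_sub_le {n m : ℕ} (hmn : m < n) (x : Fin n → ℝ) (u : ℝ) :
    |∑ j, max (x j - descOrderStat x m) 0 - ∑ j, max (x j - u) 0 +
      (m + 1) * (descOrderStat x m - u)| ≤
    |descOrderStat x m - u| * |((Finset.univ.filter fun j => u < x j).card : ℝ) - (m + 1)| := by
  set T := descOrderStat x m with hT
  have hge : ((m : ℝ) + 1) ≤ (Finset.univ.filter fun j => T ≤ x j).card := by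
    exact_mod_cast card_ge_descOrderStat x ⟨m, hmn⟩
  have hlt : ((Finset.univ.filter fun j => T < x j).card : ℝ) ≤ m + 1 := by
    have h := (lt_descOrderStat_iff x ⟨m, hmn⟩ T).not.1 (lt_irrefl _)
    simp only [not_le] at h
    exact_mod_cast h.le
  rw [← Finset.sum_boole] at hge hlt ⊢
  set N := ∑ j, if u < x j then (1:ℝ) else 0
  rw [← Finset.sum_sub_distrib]
  rcases le_total u T with h | h
  · have h1 : (T - u) * ∑ j, (if T ≤ x j then (1:ℝ) else 0) ≤
        ∑ j, (max (x j - u) 0 - max (x j - T) 0) := by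
      rw [Finset.mul_sum]
      refine Finset.sum_le_sum fun j _ => ?_
      split_ifs with hj
      · rw [max_eq_left (by linarith), max_eq_left (by linarith)]; linarith
      · rw [max_eq_right (a := x j - T) (by linarith)]
        simp
    have h2 : ∑ j, (max (x j - u) 0 - max (x j - T) 0) ≤ (T - u) * N := by
      rw [Finset.mul_sum]
      refine Finset.sum_le_sum fun j _ => ?_
      split_ifs with hj
      · rw [max_eq_left (by linarith)]
        have := le_max_left (x j - T) 0
        linarith
      · rw [max_eq_right (by linarith), max_eq_right (by linarith)]; simp
    have h3 : ∑ j, (max (x j - T) 0 - max (x j - u) 0) =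
        -∑ j, (max (x j - u) 0 - max (x j - T) 0) := by
      rw [← Finset.sum_neg_distrib]; exact Finset.sum_congr rfl fun _ _ => by ring
    have h4 : (T - u) * (m + 1) ≤ (T - u) * ∑ j, (if T ≤ x j then (1:ℝ) else 0) :=
      mul_le_mul_of_nonneg_left hge (by linarith)
    have h5 : (T - u) * (N - (m + 1)) ≤ |T - u| * |N - (m + 1)| := by
      rw [← abs_mul]; exact le_abs_self _
    rw [h3, abs_le]
    constructor <;> nlinarith
  · have h1 : (u - T) * N ≤ ∑ j, (max (x j - T) 0 - max (x j - u) 0) := by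
      rw [Finset.mul_sum]
      refine Finset.sum_le_sum fun j _ => ?_
      split_ifs with hj
      · rw [max_eq_left (by linarith), max_eq_left (by linarith)]; linarith
      · rw [max_eq_right (a := x j - u) (by linarith)]
        simp
    have h2 : ∑ j, (max (x j - T) 0 - max (x j - u) 0) ≤
        (u - T) * ∑ j, (if T < x j then (1:ℝ) else 0) := by
      rw [Finset.mul_sum]
      refine Finset.sum_le_sum fun j _ => ?_
      split_ifs with hj
      · rw [max_eq_left (by linarith)]
        have := le_max_left (x j - u) 0
        linarith
      · rw [max_eq_right (by linarith), max_eq_right (by linarith)]; simp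
    have h4 : (u - T) * ∑ j, (if T < x j then (1:ℝ) else 0) ≤ (u - T) * (m + 1) :=
      mul_le_mul_of_nonneg_left hlt (by linarith)
    have h5 : -((T - u) * (N - (m + 1))) ≤ |T - u| * |N - (m + 1)| := by
      rw [← abs_mul]; exact neg_le_abs _
    have h6 : (T - u) * (N - (m + 1)) ≤ |T - u| * |N - (m + 1)| := by
      rw [← abs_mul]; exact le_abs_self _
    have h7 : 0 ≤ |T - u| * |N - (m + 1)| := by positivity
    rw [abs_le]
    constructor <;> nlinarith

theorem measurable_descOrderStat (n i : ℕ) :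
    Measurable fun x : Fin n → ℝ => descOrderStat x i := by
  by_cases hi : i < n
  · refine measurable_of_Ioi fun v => ?_
    have : (fun x : Fin n → ℝ => descOrderStat x i) ⁻¹' Set.Ioi v =
        (fun x : Fin n → ℝ => ∑ j, if v < x j then 1 else 0) ⁻¹' Set.Ici (i + 1) := by
      ext x
      simpa using lt_descOrderStat_iff x ⟨i, hi⟩ v
    rw [this]
    refine measurableSet_Ici.preimage (Finset.measurable_sum _ fun j _ => ?_)
    exact Measurable.ite (measurableSet_lt measurable_const (measurable_pi_apply j))
      measurable_const measurable_const
  · simp only [descOrderStat, hi, dif_neg, not_false_eq_true]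
    exact measurable_const

theorem measurable_omegaStat (k : ℕ) : Measurable (omegaStat k) := by
  unfold omegaStat
  fun_prop

theorem aemeasurable_omegaSample {Ω : Type*} [MeasurableSpace Ω] {P : Measure Ω}
    {Y : ℕ → Ω → ℝ} (hY : ∀ i, AEMeasurable (Y i) P) (n k : ℕ) :
    AEMeasurable (omegaSample Y n k) P := by
  have h1 : Measurable fun x : Fin n → ℝ => omegaStat k fun i => descOrderStat x i :=
    (measurable_omegaStat k).comp (measurable_pi_lambda _ fun i => measurable_descOrderStat n i)
  exact h1.comp_aemeasurable (aemeasurable_pi_lambda _ fun j => hY j)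

/-! ### Quantiles and hazard of a continuous distribution function. -/

section Quantile

variable {μ : Measure ℝ}

theorem quantile_le_iff (hF : Continuous (cdf μ)) {p : ℝ} (hp0 : 0 < p) (hp1 : p < 1) (x : ℝ) :
    quantile μ p ≤ x ↔ p ≤ cdf μ x := by
  have hne : {x : ℝ | p ≤ cdf μ x}.Nonempty := by
    obtain ⟨x, hx⟩ := ((tendsto_cdf_atTop μ).eventually (lt_mem_nhds hp1)).exists
    exact ⟨x, hx.le⟩
  have hbdd : BddBelow {x : ℝ | p ≤ cdf μ x} := by
    obtain ⟨y, hy⟩ := ((tendsto_cdf_atBot μ).eventually (gt_mem_nhds hp0)).exists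
    refine ⟨y, fun x hx => ?_⟩
    by_contra h
    exact absurd ((Set.mem_ofPred.1 hx).trans (monotone_cdf μ (not_le.1 h).le)) (not_le.2 hy)
  have hcl : IsClosed {x : ℝ | p ≤ cdf μ x} := isClosed_le continuous_const hF
  constructor
  · intro h
    exact (Set.mem_ofPred.1 (hcl.csInf_mem hne hbdd)).trans (monotone_cdf μ h)
  · intro h
    exact csInf_le hbdd h

theorem cdf_quantile (hF : Continuous (cdf μ)) {p : ℝ} (hp0 : 0 < p) (hp1 : p < 1) :
    cdf μ (quantile μ p) = p := by
  refine le_antisymm ?_ ((quantile_le_iff hF hp0 hp1 _).1 le_rfl)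
  -- To the left of the quantile the distribution function is below `p`; continuity excludes a jump.
  refine le_of_tendsto (hF.continuousWithinAt (s := Set.Iio (quantile μ p))).tendsto ?_
  filter_upwards [self_mem_nhdsWithin] with x hx
  exact (not_le.1 ((quantile_le_iff hF hp0 hp1 x).not.1 (not_le.2 hx))).le

/-- The tail quantile on the logarithmic scale. -/
noncomputable def logQuantile (μ : Measure ℝ) (s : ℝ) : ℝ := tailQuantile μ (Real.exp s)

/-- The cumulative hazard `-log (1 - F)`. -/
noncomputable def hazard (μ : Measure ℝ) (y : ℝ) : ℝ := -Real.log (1 - cdf μ y)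

theorem logQuantile_eq (s : ℝ) : logQuantile μ s = quantile μ (1 - Real.exp (-s)) := by
  rw [logQuantile, tailQuantile, Real.exp_neg, one_div]

theorem one_sub_exp_neg_mem {s : ℝ} (hs : 0 < s) :
    0 < 1 - Real.exp (-s) ∧ 1 - Real.exp (-s) < 1 :=
  ⟨by simpa using hs, by have := Real.exp_pos (-s); linarith⟩

theorem logQuantile_le_iff (hF : Continuous (cdf μ)) {s : ℝ} (hs : 0 < s) (x : ℝ) :
    logQuantile μ s ≤ x ↔ 1 - Real.exp (-s) ≤ cdf μ x := by
  rw [logQuantile_eq]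
  exact quantile_le_iff hF (one_sub_exp_neg_mem hs).1 (one_sub_exp_neg_mem hs).2 x

theorem cdf_logQuantile (hF : Continuous (cdf μ)) {s : ℝ} (hs : 0 < s) :
    cdf μ (logQuantile μ s) = 1 - Real.exp (-s) := by
  rw [logQuantile_eq]
  exact cdf_quantile hF (one_sub_exp_neg_mem hs).1 (one_sub_exp_neg_mem hs).2

theorem hazard_logQuantile (hF : Continuous (cdf μ)) {s : ℝ} (hs : 0 < s) :
    hazard μ (logQuantile μ s) = s := by
  rw [hazard, cdf_logQuantile hF hs]
  simp

theorem logQuantile_mono (hF : Continuous (cdf μ)) {s t : ℝ} (hs : 0 < s) (hst : s ≤ t) :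
    logQuantile μ s ≤ logQuantile μ t := by
  rw [logQuantile_le_iff hF hs, cdf_logQuantile hF (hs.trans_le hst)]
  have := Real.exp_le_exp.2 (neg_le_neg hst)
  linarith

theorem lt_logQuantile_iff (hF : Continuous (cdf μ)) {s : ℝ} (hs : 0 < s) (x : ℝ) :
    x < logQuantile μ s ↔ cdf μ x < 1 - Real.exp (-s) := by
  rw [← not_le, logQuantile_le_iff hF hs, not_le]

theorem gumbelScale_exp (t : ℝ) :
    gumbelScale μ (Real.exp t) = logQuantile μ (t + 1) - logQuantile μ t := by
  rw [gumbelScale, logQuantile, logQuantile, ← Real.exp_add, add_comm 1 t]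

end Quantile

/-! ### Regular variation of the hazard and increments of the quantile. -/

section Law

variable {μ : Measure ℝ} {ρ : ℝ}

/-- Product rule for `L(y) y^ρ`, with `e(y) = y L'(y) / L(y)`. Division by `L` is legitimate because
the hazard is nonzero once the distribution function is positive. -/
theorem IsLogExpPowerLaw.hazard_hasDerivAt (hμ : IsLogExpPowerLaw μ ρ) :
    ∃ e : ℝ → ℝ, Tendsto e atTop (𝓝 0) ∧
      ∀ᶠ y in atTop, HasDerivAt (hazard μ) (hazard μ y / y * (ρ + e y)) y := by
  obtain ⟨L, hL, -, hd, he, -⟩ := hμ.exists_slowlyVarying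
  refine ⟨_, he, ?_⟩
  obtain ⟨y0, hy0⟩ := eventually_atTop.1 hL
  have hz : ∀ y, y0 ≤ y → hazard μ y = L y * y ^ ρ := fun y hy => by
    rw [hazard, hy0 y hy]; simp
  have hpos : ∀ᶠ y in atTop, hazard μ y ≠ 0 := by
    have h1 := (tendsto_cdf_atTop μ).eventually (lt_mem_nhds (show (0:ℝ) < 1 by norm_num))
    filter_upwards [h1, eventually_ge_atTop y0] with y hy hy1
    rw [hz y hy1]
    intro h0
    have := hy0 y hy1
    rw [h0] at this
    simp at this
    linarith
  filter_upwards [hd, hpos, eventually_gt_atTop y0, eventually_gt_atTop 0] with y hdy hny hy hyp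
  have hLy : L y ≠ 0 := fun h => hny (by rw [hz y hy.le, h, zero_mul])
  have h1 : HasDerivAt (fun y => L y * y ^ ρ) (deriv L y * y ^ ρ + L y * (ρ * y ^ (ρ - 1))) y :=
    hdy.1.hasDerivAt.mul (Real.hasDerivAt_rpow_const (Or.inl hyp.ne'))
  have h2 : HasDerivAt (hazard μ) (deriv L y * y ^ ρ + L y * (ρ * y ^ (ρ - 1))) y :=
    h1.congr_of_eventuallyEq (by
      filter_upwards [Ioi_mem_nhds hy] with z hzz using hz z (le_of_lt hzz))
  convert h2 using 1
  rw [hz y hy.le, Real.rpow_sub_one hyp.ne']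
  field_simp
  ring

theorem IsLogExpPowerLaw.cdf_lt_one (hμ : IsLogExpPowerLaw μ ρ) (y : ℝ) : cdf μ y < 1 := by
  obtain ⟨L, hL, -⟩ := hμ.exists_slowlyVarying
  obtain ⟨z, hz, hyz⟩ := (hL.and (eventually_ge_atTop y)).exists
  have := Real.exp_pos (-(L z * z ^ ρ))
  have := monotone_cdf μ hyz
  linarith

theorem IsLogExpPowerLaw.tendsto_logQuantile (hμ : IsLogExpPowerLaw μ ρ) :
    Tendsto (logQuantile μ) atTop atTop := by
  rw [tendsto_atTop]
  intro y
  have h1 : Tendsto (fun s : ℝ => 1 - Real.exp (-s)) atTop (𝓝 (1 - 0)) :=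
    tendsto_const_nhds.sub (Real.tendsto_exp_neg_atTop_nhds_zero)
  rw [sub_zero] at h1
  filter_upwards [h1.eventually (lt_mem_nhds (hμ.cdf_lt_one y)), eventually_gt_atTop 0] with s hs hs0
  exact ((lt_logQuantile_iff hμ.continuous_cdf hs0 y).2 hs).le

/-- Since `ρ > 1`, `h(y) / y` is eventually increasing, so the derivative at the mean value point is
controlled by the endpoints, however far apart they are. -/
theorem IsLogExpPowerLaw.hazard_sub_bounds (hμ : IsLogExpPowerLaw μ ρ) {δ : ℝ} (hδ : 0 < δ)
    (hδ1 : δ < 1) :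
    ∃ y0 > 0, ∀ y ≥ y0, ∀ z ≥ y, 0 < hazard μ y ∧
      (z - y) * (hazard μ y / y * (ρ * (1 - δ))) ≤ hazard μ z - hazard μ y ∧
      hazard μ z - hazard μ y ≤ (z - y) * (hazard μ z / z * (ρ * (1 + δ))) := by
  have hρ := hμ.one_lt
  obtain ⟨e, he, hd⟩ := hμ.hazard_hasDerivAt
  -- The bound `ρ - 1` gives monotonicity of `h(y) / y`; the bound `ρ δ` gives the factors `1 ± δ`.
  have hmin : 0 < min (ρ - 1) (ρ * δ) := lt_min (by linarith) (by positivity)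
  have he1 : ∀ᶠ y in atTop, |e y| < min (ρ - 1) (ρ * δ) := by
    have := he.abs
    rw [abs_zero] at this
    exact this.eventually (gt_mem_nhds hmin)
  have hpos : ∀ᶠ y in atTop, 0 < hazard μ y := by
    filter_upwards [(tendsto_cdf_atTop μ).eventually (lt_mem_nhds (zero_lt_one))] with y hy
    rw [hazard, neg_pos]
    exact Real.log_neg (by linarith [hμ.cdf_lt_one y]) (by linarith)
  obtain ⟨y0, hy0⟩ := eventually_atTop.1 (((hd.and he1).and hpos).and (eventually_gt_atTop 0))
  refine ⟨max y0 1, by positivity, ?_⟩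
  have hy0' : ∀ y, max y0 1 ≤ y → _ := fun y hy => hy0 y ((le_max_left _ _).trans hy)
  have hmono : MonotoneOn (fun y => hazard μ y / y) (Set.Ici (max y0 1)) := by
    have hder : ∀ y ∈ Set.Ici (max y0 1), HasDerivAt (fun y => hazard μ y / y)
        ((hazard μ y / y * (ρ + e y) * y - hazard μ y * 1) / y ^ 2) y := fun y hy => by
      obtain ⟨⟨⟨h1, -⟩, -⟩, h4⟩ := hy0' y hy
      exact h1.div (hasDerivAt_id y) h4.ne'
    refine monotoneOn_of_deriv_nonneg (convex_Ici _)
      (fun y hy => (hder y hy).continuousAt.continuousWithinAt)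
      (fun y hy => (hder y (interior_subset hy)).differentiableAt.differentiableWithinAt) ?_
    intro y hy
    have hy' := interior_subset hy
    obtain ⟨⟨⟨-, h2⟩, h3⟩, h4⟩ := hy0' y hy'
    rw [(hder y hy').deriv]
    have h5 := (abs_lt.1 (h2.trans_le (min_le_left _ _))).1
    have : hazard μ y / y * (ρ + e y) * y - hazard μ y * 1 = hazard μ y * (ρ + e y - 1) := by
      field_simp
    rw [this]
    have : 0 ≤ ρ + e y - 1 := by linarith
    positivity
  intro y hy z hyz
  obtain ⟨⟨⟨-, -⟩, h3⟩, h4⟩ := hy0' y hy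
  refine ⟨h3, ?_⟩
  rcases eq_or_lt_of_le hyz with rfl | hlt
  · simp
  obtain ⟨c, hc, hc'⟩ := exists_hasDerivAt_eq_slope (hazard μ)
    (fun y => hazard μ y / y * (ρ + e y)) hlt
    (fun x hx => (hy0' x (hy.trans hx.1)).1.1.1.continuousAt.continuousWithinAt)
    (fun x hx => (hy0' x (hy.trans hx.1.le)).1.1.1)
  obtain ⟨⟨⟨-, g2⟩, g3⟩, g4⟩ := hy0' c (hy.trans hc.1.le)
  have hzy : 0 < z - y := sub_pos.2 hlt
  rw [eq_div_iff hzy.ne'] at hc'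
  rw [← hc', mul_comm]
  obtain ⟨g5, g6⟩ := abs_lt.1 (g2.trans_le (min_le_right _ _))
  have m1 : hazard μ y / y ≤ hazard μ c / c :=
    hmono hy (Set.mem_Ici.2 (hy.trans hc.1.le)) hc.1.le
  have m2 : hazard μ c / c ≤ hazard μ z / z :=
    hmono (Set.mem_Ici.2 (hy.trans hc.1.le)) (Set.mem_Ici.2 (le_trans hy hyz)) hc.2.le
  have p1 : 0 < hazard μ y / y := by positivity
  have p2 : 0 < hazard μ c / c := by positivity
  constructor
  · refine mul_le_mul_of_nonneg_right ?_ hzy.le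
    refine mul_le_mul m1 (by nlinarith) ?_ p2.le
    have : 0 < 1 - δ := by linarith
    positivity
  · rw [mul_comm (z - y)]
    refine mul_le_mul_of_nonneg_right ?_ hzy.le
    refine mul_le_mul m2 (by nlinarith) ?_ (p2.le.trans m2)
    nlinarith

/-- The asymptotic slope of `logQuantile` at `t`. -/
noncomputable def logQuantileSlope (μ : Measure ℝ) (ρ t : ℝ) : ℝ := logQuantile μ t / (ρ * t)

/-- The hazard bounds are inverted at `y = Q(t)`, `z = Q(s)`, where `h(z) - h(y) = s - t`. No bound
on `s - t` is imposed, which later supplies a dominating function. -/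
theorem IsLogExpPowerLaw.logQuantile_sub_bounds (hμ : IsLogExpPowerLaw μ ρ) {δ : ℝ} (hδ : 0 < δ)
    (hδ1 : δ < 1) :
    ∀ᶠ t in atTop, 0 < t ∧ 0 < logQuantileSlope μ ρ t ∧ ∀ s ≥ t,
      (1 - δ) * (t / s * ((s - t) * logQuantileSlope μ ρ t)) ≤
        logQuantile μ s - logQuantile μ t ∧
      logQuantile μ s - logQuantile μ t ≤ (1 + δ) * ((s - t) * logQuantileSlope μ ρ t) := by
  have hρ := hμ.one_lt
  -- Chosen so that `1 / (1 - δ / (1 + δ)) = 1 + δ`.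
  have hδ' : 0 < δ / (1 + δ) := by positivity
  have hδ'' : δ / (1 + δ) < 1 := by rw [div_lt_one (by positivity)]; linarith
  obtain ⟨y0, hy0, hb⟩ := hμ.hazard_sub_bounds hδ' hδ''
  filter_upwards [eventually_gt_atTop 0, hμ.tendsto_logQuantile.eventually_ge_atTop y0]
    with t ht hQ
  have hQ0 : 0 < logQuantile μ t := hy0.trans_le hQ
  refine ⟨ht, by unfold logQuantileSlope; positivity, fun s hs => ?_⟩
  have hs0 : 0 < s := ht.trans_le hs
  have hmono := logQuantile_mono hμ.continuous_cdf ht hs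
  obtain ⟨-, h1, h2⟩ := hb _ hQ _ hmono
  rw [hazard_logQuantile hμ.continuous_cdf ht, hazard_logQuantile hμ.continuous_cdf hs0] at h1 h2
  have hQs : 0 < logQuantile μ s := hQ0.trans_le hmono
  unfold logQuantileSlope
  set y := logQuantile μ t
  set z := logQuantile μ s
  have e1 : 1 - δ / (1 + δ) = 1 / (1 + δ) := by field_simp; ring
  have hzy : 0 ≤ z - y := by linarith
  have hst : 0 ≤ s - t := by linarith
  constructor
  · have h3 : s - t ≤ (z - y) * (s / y * (ρ * (1 + δ / (1 + δ)))) := by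
      refine h2.trans ?_
      gcongr
    have h4 : (1 - δ) * (1 + δ / (1 + δ)) ≤ 1 := by
      rw [show (1 - δ) * (1 + δ / (1 + δ)) = (1 - δ) * (1 + 2 * δ) / (1 + δ) by field_simp; ring,
        div_le_one (by positivity)]
      nlinarith
    have h5 : t / s * ((s - t) * (y / (ρ * t))) = (s - t) * y / (ρ * s) := by field_simp
    rw [h5]
    calc (1 - δ) * ((s - t) * y / (ρ * s))
        ≤ (1 - δ) * ((z - y) * (s / y * (ρ * (1 + δ / (1 + δ)))) * y / (ρ * s)) := by
          have : 0 < 1 - δ := by linarith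
          gcongr
      _ = (z - y) * ((1 - δ) * (1 + δ / (1 + δ))) := by field_simp
      _ ≤ (z - y) * 1 := by gcongr
      _ = z - y := mul_one _
  · rw [e1] at h1
    have h6 : (1 + δ) * ((s - t) * (y / (ρ * t))) = (s - t) / (t / y * (ρ * (1 / (1 + δ)))) := by
      field_simp
    rw [h6, le_div_iff₀ (by positivity)]
    exact h1

/-- On a window of fixed length both `Q(t)` and `t` change by a relative amount of order `1/t`,
hence so does their ratio. -/
theorem IsLogExpPowerLaw.abs_slope_sub_le (hμ : IsLogExpPowerLaw μ ρ) {ε : ℝ} (hε : 0 < ε)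
    {M : ℝ} (hM : 0 < M) :
    ∀ᶠ t in atTop, ∀ s, t ≤ s → s - t ≤ M →
      |logQuantileSlope μ ρ s - logQuantileSlope μ ρ t| ≤ ε * logQuantileSlope μ ρ s := by
  have hρ := hμ.one_lt
  filter_upwards [hμ.logQuantile_sub_bounds (δ := 1 / 2) (by norm_num) (by norm_num),
    eventually_ge_atTop (2 * M / ε)] with t ⟨ht, hb, h⟩ ht2 s hs hsM
  obtain ⟨-, h2⟩ := h s hs
  have hmono : logQuantile μ t ≤ logQuantile μ s := logQuantile_mono hμ.continuous_cdf ht hs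
  have hs0 : 0 < s := ht.trans_le hs
  have hMt : 2 * M ≤ ε * t := by rw [div_le_iff₀ hε] at ht2; linarith
  unfold logQuantileSlope at *
  set y := logQuantile μ t
  set z := logQuantile μ s
  have hy : 0 < y := by
    by_contra hcon
    exact absurd hb (not_lt.2 (div_nonpos_of_nonpos_of_nonneg (not_lt.1 hcon) (by positivity)))
  have h2' : z - y ≤ 2 * M * (y / t) := by
    refine h2.trans ?_
    calc (1 + 1 / 2) * ((s - t) * (y / (ρ * t))) ≤ 2 * (M * (y / (1 * t))) := by
          gcongr; norm_num
      _ = 2 * M * (y / t) := by ring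
  have h3 : z - y ≤ ε * y := by
    refine h2'.trans ?_
    rw [mul_div_assoc', div_le_iff₀ ht]
    nlinarith
  have e1 : z / (ρ * s) - y / (ρ * t) = (z * t - y * s) / (ρ * s * t) := by field_simp
  have e2 : ε * (z / (ρ * s)) = ε * z * t / (ρ * s * t) := by field_simp
  rw [e1, e2, abs_div, abs_of_pos (show 0 < ρ * s * t by positivity)]
  gcongr
  rw [abs_le]
  constructor
  · nlinarith [mul_nonneg hy.le (sub_nonneg.2 hs)]
  · nlinarith [mul_nonneg hy.le (sub_nonneg.2 hs)]

theorem IsLogExpPowerLaw.abs_logQuantile_sub_slope_le (hμ : IsLogExpPowerLaw μ ρ) {ε : ℝ}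
    (hε : 0 < ε) (hε1 : ε < 1) {M : ℝ} (hM : 0 < M) :
    ∀ᶠ t in atTop, 0 < logQuantileSlope μ ρ t ∧ ∀ d, |d| ≤ M →
      |logQuantile μ (t + d) - logQuantile μ t - d * logQuantileSlope μ ρ t| ≤
        ε * (|d| * logQuantileSlope μ ρ t) := by
  have hup : ∀ η, 0 < η → η < 1 → ∀ᶠ t in atTop, 0 < logQuantileSlope μ ρ t ∧ ∀ d, 0 ≤ d → d ≤ M →
      |logQuantile μ (t + d) - logQuantile μ t - d * logQuantileSlope μ ρ t| ≤
        η * (d * logQuantileSlope μ ρ t) := by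
    intro η hη hη1
    filter_upwards [hμ.logQuantile_sub_bounds (δ := η / 2) (by positivity) (by linarith),
      eventually_ge_atTop (2 * M / η)] with t ⟨ht, hb, h⟩ ht2
    refine ⟨hb, fun d hd hdM => ?_⟩
    obtain ⟨h1, h2⟩ := h (t + d) (by linarith)
    rw [add_sub_cancel_left] at h1 h2
    have hx : 0 ≤ d * logQuantileSlope μ ρ t := by positivity
    set x := d * logQuantileSlope μ ρ t
    have h3 : 1 - η / 2 ≤ t / (t + d) := by
      rw [le_div_iff₀ (by positivity)]
      have : 2 * M ≤ η * t := by rw [div_le_iff₀ hη] at ht2; linarith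
      nlinarith
    have h4 : (1 - η / 2) * ((1 - η / 2) * x) ≤ (1 - η / 2) * (t / (t + d) * x) := by
      have : 0 < 1 - η / 2 := by linarith
      gcongr
    rw [abs_le]
    constructor
    · nlinarith
    · nlinarith
  -- A negative increment is expanded from the base point `t + d`, and its slope is then compared
  -- with the one at `t`; both points must lie beyond `T`.
  obtain ⟨T, hT⟩ := eventually_atTop.1 ((hup (ε / 4) (by positivity) (by linarith)).and
    (hμ.abs_slope_sub_le (ε := ε / 4) (by positivity) hM))
  filter_upwards [eventually_ge_atTop (T + M), eventually_ge_atTop T] with t ht ht'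
  obtain ⟨⟨hb, h1⟩, -⟩ := hT t ht'
  refine ⟨hb, fun d hd => ?_⟩
  rcases le_total 0 d with h0 | h0
  · rw [abs_of_nonneg h0] at hd ⊢
    refine (h1 d h0 hd).trans ?_
    have : 0 ≤ d * logQuantileSlope μ ρ t := by positivity
    nlinarith
  · rw [abs_of_nonpos h0] at hd ⊢
    obtain ⟨⟨hb', h2⟩, h3⟩ := hT (t + d) (by linarith)
    have h2' := h2 (-d) (by linarith) hd
    have h3' := h3 t (by linarith) (by linarith)
    rw [show t + d + -d = t by ring] at h2'
    set b := logQuantileSlope μ ρ t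
    set b' := logQuantileSlope μ ρ (t + d)
    obtain ⟨g1, g2⟩ := abs_le.1 h3'
    obtain ⟨g3, g4⟩ := abs_le.1 h2'
    have hD : 0 ≤ -d := by linarith
    have k1 : -d * b' ≤ -d * b * (1 + ε / 4) := by nlinarith
    have k2 : -d * b * (1 - ε / 4) ≤ -d * b' := by nlinarith
    have k3 : 0 ≤ -d * b := by positivity
    rw [abs_le]
    constructor <;> nlinarith

/-- The increment `U(e t) - U(t)` on the logarithmic scale. -/
noncomputable def logScale (μ : Measure ℝ) (t : ℝ) : ℝ := logQuantile μ (t + 1) - logQuantile μ t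

/-- The expansion at `d = 1` shows that the slope and `logScale` are equivalent, so one replaces the
other. Uniformity on bounded sets of `d` permits increments that depend on `n`. -/
theorem IsLogExpPowerLaw.abs_logQuantile_sub_le (hμ : IsLogExpPowerLaw μ ρ) {ε : ℝ}
    (hε : 0 < ε) {M : ℝ} (hM : 0 < M) :
    ∀ᶠ t in atTop, 0 < logScale μ t ∧ ∀ d, |d| ≤ M →
      |logQuantile μ (t + d) - logQuantile μ t - d * logScale μ t| ≤ ε * (|d| * logScale μ t) := by
  set η := min (ε / 4) (1 / 2) with hη
  have hη0 : 0 < η := by positivity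
  have hη1 : η ≤ ε / 4 := min_le_left _ _
  have hη2 : η ≤ 1 / 2 := min_le_right _ _
  filter_upwards [hμ.abs_logQuantile_sub_slope_le hη0 (by linarith) hM,
    hμ.abs_logQuantile_sub_slope_le hη0 (by linarith) one_pos] with t ⟨hb, h1⟩ ⟨_, h2⟩
  have h3 := h2 1 (by simp)
  rw [show logQuantile μ (t + 1) - logQuantile μ t = logScale μ t from rfl] at h3
  set a := logScale μ t
  set b := logQuantileSlope μ ρ t
  rw [one_mul, abs_one, one_mul] at h3
  obtain ⟨g1, g2⟩ := abs_le.1 h3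
  have hba : b ≤ 2 * a := by nlinarith
  have ha : 0 < a := by linarith
  refine ⟨ha, fun d hd => ?_⟩
  have h4 := h1 d hd
  calc |logQuantile μ (t + d) - logQuantile μ t - d * a|
      = |(logQuantile μ (t + d) - logQuantile μ t - d * b) + -(d * (a - b))| := by ring_nf
    _ ≤ |logQuantile μ (t + d) - logQuantile μ t - d * b| + |d| * |a - b| := by
        refine (abs_add_le _ _).trans ?_
        rw [abs_neg, abs_mul]
    _ ≤ η * (|d| * b) + |d| * (η * b) := by gcongr
    _ = 2 * η * (|d| * b) := by ring
    _ ≤ 2 * (ε / 4) * (|d| * (2 * a)) := by gcongr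
    _ = ε * (|d| * a) := by ring

/-- A global linear bound, used for domination. The constant is `3/2` from the upper quantile bound
times `2` from slope `≤ 2 * logScale`. -/
theorem IsLogExpPowerLaw.logQuantile_sub_le (hμ : IsLogExpPowerLaw μ ρ) :
    ∀ᶠ t in atTop, 0 < t ∧ 0 < logScale μ t ∧ ∀ x, 0 ≤ x →
      0 ≤ logQuantile μ (t + x) - logQuantile μ t ∧
      logQuantile μ (t + x) - logQuantile μ t ≤ 3 * x * logScale μ t := by
  filter_upwards [hμ.logQuantile_sub_bounds (δ := 1 / 2) (by norm_num) (by norm_num),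
    hμ.abs_logQuantile_sub_slope_le (ε := 1 / 2) (by norm_num) (by norm_num) one_pos]
    with t ⟨ht, hb, h1⟩ ⟨_, h2⟩
  have h3 := h2 1 (by simp)
  rw [show logQuantile μ (t + 1) - logQuantile μ t = logScale μ t from rfl] at h3
  rw [one_mul, abs_one, one_mul] at h3
  obtain ⟨g1, g2⟩ := abs_le.1 h3
  refine ⟨ht, by linarith, fun x hx =>
    ⟨sub_nonneg.2 (logQuantile_mono hμ.continuous_cdf ht (by linarith)), ?_⟩⟩
  have h4 := (h1 (t + x) (by linarith)).2
  rw [add_sub_cancel_left] at h4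
  nlinarith

theorem IsLogExpPowerLaw.tendsto_increment (hμ : IsLogExpPowerLaw μ ρ) (d : ℝ) :
    Tendsto (fun t => (logQuantile μ (t + d) - logQuantile μ t) / logScale μ t) atTop (𝓝 d) := by
  rw [Metric.tendsto_nhds]
  intro ε hε
  have hM : 0 < |d| + 1 := by positivity
  filter_upwards [hμ.abs_logQuantile_sub_le (ε := ε / (|d| + 1)) (by positivity) hM]
    with t ⟨ha, h⟩
  have h1 := h d (by linarith)
  rw [Real.dist_eq, show (logQuantile μ (t + d) - logQuantile μ t) / logScale μ t - d =
    (logQuantile μ (t + d) - logQuantile μ t - d * logScale μ t) / logScale μ t by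
      field_simp, abs_div, abs_of_pos ha, div_lt_iff₀ ha]
  refine h1.trans_lt ?_
  rw [← mul_assoc]
  gcongr
  rw [div_mul_eq_mul_div, div_lt_iff₀ hM]
  gcongr
  linarith

/-- `logScale (t + d)` is the difference of the increments of `Q` from `t` to `t + d + 1` and to `t
+ d`. -/
theorem IsLogExpPowerLaw.tendsto_scale_ratio (hμ : IsLogExpPowerLaw μ ρ) (d : ℝ) :
    Tendsto (fun t => logScale μ (t + d) / logScale μ t) atTop (𝓝 1) := by
  have := (hμ.tendsto_increment (d + 1)).sub (hμ.tendsto_increment d)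
  rw [add_sub_cancel_left] at this
  refine this.congr fun t => ?_
  rw [← sub_div]
  congr 1
  rw [logScale, add_assoc]
  ring

end Law

/-! ### The standard exponential law. -/

instance isProbabilityMeasure_expMeasure_one : IsProbabilityMeasure (expMeasure 1) :=
  isProbabilityMeasure_expMeasure one_pos

theorem expMeasure_one_eq : expMeasure 1 =
    (volume.restrict (Set.Ioi (0:ℝ))).withDensity fun x => ENNReal.ofReal (Real.exp (-x)) := by
  rw [expMeasure, gammaMeasure, ← withDensity_indicator measurableSet_Ioi]
  refine withDensity_congr_ae ?_
  have : ∀ᵐ x : ℝ, x ≠ 0 := by simp [ae_iff]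
  filter_upwards [this] with x hx
  have h := exponentialPDF_eq 1 x
  rw [exponentialPDF, exponentialPDFReal] at h
  rw [gammaPDF, h]
  by_cases h0 : 0 < x
  · rw [Set.indicator_of_mem (Set.mem_Ioi.2 h0)]
    simp [h0.le]
  · rw [Set.indicator_of_notMem (by simpa using h0)]
    have : ¬ 0 ≤ x := fun h' => h0 (lt_of_le_of_ne h' hx.symm)
    simp [this]

theorem lintegral_expMeasure_one (f : ℝ → ENNReal) (hf : Measurable f) :
    ∫⁻ x, f x ∂expMeasure 1 = ∫⁻ x in Set.Ioi 0, ENNReal.ofReal (Real.exp (-x)) * f x := by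
  rw [expMeasure_one_eq, lintegral_withDensity_eq_lintegral_mul _ (by fun_prop) hf]
  rfl

theorem ae_expMeasure_pos : ∀ᵐ x ∂expMeasure 1, 0 < x := by
  rw [expMeasure_one_eq]
  exact (withDensity_absolutelyContinuous _ _).ae_le (ae_restrict_mem measurableSet_Ioi)

theorem integrable_pow_expMeasure (n : ℕ) : Integrable (fun x => x ^ n) (expMeasure 1) := by
  rw [expMeasure_one_eq, integrable_withDensity_iff (by fun_prop) (by simp)]
  have h := Real.GammaIntegral_convergent (s := n + 1) (by positivity)
  refine h.congr_fun (fun x hx => ?_) measurableSet_Ioi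
  simp only [add_sub_cancel_right, Real.rpow_natCast]
  rw [ENNReal.toReal_ofReal (Real.exp_pos _).le, mul_comm]

theorem integral_pow_expMeasure (n : ℕ) : ∫ x, x ^ n ∂expMeasure 1 = n.factorial := by
  rw [expMeasure_one_eq, integral_withDensity_eq_integral_toReal_smul (by fun_prop) (by simp),
    ← Real.Gamma_nat_eq_factorial, Real.Gamma_eq_integral (by positivity)]
  refine setIntegral_congr_fun measurableSet_Ioi fun x hx => ?_
  simp only [add_sub_cancel_right, Real.rpow_natCast, smul_eq_mul]
  rw [ENNReal.toReal_ofReal (Real.exp_pos _).le]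

theorem expMeasure_Iic {x : ℝ} (hx : 0 ≤ x) :
    expMeasure 1 (Set.Iic x) = ENNReal.ofReal (1 - Real.exp (-x)) := by
  rw [← ofReal_cdf, cdf_expMeasure_eq one_pos, if_pos hx, one_mul]

theorem integral_sub_one_expMeasure : ∫ x, (x - 1) ∂expMeasure 1 = 0 := by
  have h1 := integrable_pow_expMeasure 1
  have h2 := integral_pow_expMeasure 1
  simp only [pow_one] at h1 h2
  rw [integral_sub h1 (integrable_const _), h2]
  simp

theorem integral_sub_one_sq_expMeasure : ∫ x, (x - 1) ^ 2 ∂expMeasure 1 = 1 := by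
  have h1 := integrable_pow_expMeasure 1
  have h2 := integral_pow_expMeasure 1
  have h3 := integrable_pow_expMeasure 2
  have h4 := integral_pow_expMeasure 2
  simp only [pow_one] at h1 h2
  have : ∀ x : ℝ, (x - 1) ^ 2 = x ^ 2 - 2 * x + 1 := fun x => by ring
  simp only [this]
  have h5 : Integrable (fun x : ℝ => x ^ 2 - 2 * x) (expMeasure 1) := h3.sub (h1.const_mul 2)
  rw [integral_add h5 (integrable_const _), integral_sub h3 (h1.const_mul 2), integral_const_mul,
    h2, h4]
  norm_num [Nat.factorial]

/-- The characteristic function of a centred standard exponential variable. -/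
noncomputable def expCharFun (θ : ℝ) : ℂ := charFun ((expMeasure 1).map fun x => x - 1) θ

theorem isLittleO_expCharFun :
    (fun t => expCharFun t - (1 - t ^ 2 / 2)) =o[𝓝 0] fun t => t ^ 2 :=
  taylor_charFun_two (P := expMeasure 1) (X := fun x => x - 1) (by fun_prop)
    integral_sub_one_expMeasure integral_sub_one_sq_expMeasure

/-! ### Exceedances of a high quantile as images of the exponential law. -/

section

variable {μ : Measure ℝ}

theorem logQuantile_le_iff_hazard (hF : Continuous (cdf μ)) (hlt : ∀ y, cdf μ y < 1) {s : ℝ}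
    (hs : 0 < s) (y : ℝ) : logQuantile μ s ≤ y ↔ s ≤ hazard μ y := by
  rw [logQuantile_le_iff hF hs, hazard, le_neg,
    Real.log_le_iff_le_exp (by linarith [hlt y])]
  constructor <;> intro h <;> linarith

/-- Truncating at `0` keeps the argument in the range where the quantile is known to be monotone;
the exponential law does not see the change. -/
theorem measurable_logQuantile_add_max (hF : Continuous (cdf μ)) {t : ℝ} (ht : 0 < t) :
    Measurable fun x => logQuantile μ (t + max x 0) := by
  refine Monotone.measurable fun x y hxy => logQuantile_mono hF ?_ ?_
  · have := le_max_right x 0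
    linarith
  · gcongr

theorem measurable_hazard (hF : Continuous (cdf μ)) : Measurable (hazard μ) := by
  unfold hazard
  have := hF.measurable
  fun_prop

theorem measure_Ioi_logQuantile [IsProbabilityMeasure μ] (hF : Continuous (cdf μ)) {t : ℝ} (ht : 0 < t) :
    μ.real (Set.Ioi (logQuantile μ t)) = Real.exp (-t) := by
  rw [← Set.compl_Iic, probReal_compl_eq_one_sub measurableSet_Iic, ← cdf_eq_real,
    cdf_logQuantile hF ht]
  ring

/-- The law of the observations beyond a high quantile is an image of the exponential law. -/
theorem restrict_Ioi_logQuantile [IsProbabilityMeasure μ] (hF : Continuous (cdf μ)) (hlt : ∀ y, cdf μ y < 1) {t : ℝ}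
    (ht : 0 < t) : μ.restrict (Set.Ioi (logQuantile μ t)) =
      ENNReal.ofReal (Real.exp (-t)) •
        (expMeasure 1).map fun x => logQuantile μ (t + max x 0) := by
  have hm := measurable_logQuantile_add_max hF ht
  refine Measure.ext_of_Iic _ _ fun y => ?_
  rw [Measure.restrict_apply measurableSet_Iic, Measure.smul_apply,
    Measure.map_apply hm measurableSet_Iic, smul_eq_mul]
  have hset : (fun x => logQuantile μ (t + max x 0)) ⁻¹' Set.Iic y =
      {x | t + max x 0 ≤ hazard μ y} := by
    ext x
    have := le_max_right x 0
    exact logQuantile_le_iff_hazard hF hlt (by linarith) y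
  rw [hset]
  -- Above the threshold, `F(y) - F(Q(t)) = e^{-t} (1 - e^{-(h(y) - t)})`; below it both sides are
  -- zero.
  rcases le_or_gt t (hazard μ y) with h | h
  · have hQ := (logQuantile_le_iff_hazard hF hlt ht y).2 h
    have h1 : {x | t + max x 0 ≤ hazard μ y} = Set.Iic (hazard μ y - t) := by
      ext x
      simp only [Set.mem_ofPred_eq, Set.mem_Iic]
      constructor
      · intro hx
        have := le_max_left x 0
        linarith
      · intro hx
        rcases max_cases x 0 with ⟨h', -⟩ | ⟨h', -⟩ <;> rw [h'] <;> linarith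
    rw [h1, expMeasure_Iic (by linarith), ← ENNReal.ofReal_mul (Real.exp_pos _).le,
      Set.inter_comm, Set.Ioi_inter_Iic, ← measure_cdf μ, StieltjesFunction.measure_Ioc,
      measure_cdf, cdf_logQuantile hF ht]
    congr 1
    have h2 : Real.exp (-hazard μ y) = 1 - cdf μ y := by
      rw [hazard, neg_neg, Real.exp_log (by linarith [hlt y])]
    rw [mul_sub, ← Real.exp_add, show -t + -(hazard μ y - t) = -hazard μ y by ring, h2]
    ring
  · have h1 : {x | t + max x 0 ≤ hazard μ y} = ∅ := by
      ext x
      have := le_max_right x 0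
      simp only [Set.mem_ofPred_eq, Set.mem_empty_iff_false, iff_false, not_le]
      linarith
    have hQ := (logQuantile_le_iff_hazard hF hlt ht y).not.2 (not_le.2 h)
    rw [h1, Set.inter_comm, Set.Ioi_inter_Iic, Set.Ioc_eq_empty (by simpa using (not_le.1 hQ).le)]
    simp

theorem setIntegral_Ioi_logQuantile [IsProbabilityMeasure μ] {E : Type*} [NormedAddCommGroup E] [NormedSpace ℝ E]
    (hF : Continuous (cdf μ)) (hlt : ∀ y, cdf μ y < 1) {t : ℝ}
    (ht : 0 < t) {f : ℝ → E} (hf : StronglyMeasurable f) :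
    ∫ y in Set.Ioi (logQuantile μ t), f y ∂μ =
      Real.exp (-t) • ∫ x, f (logQuantile μ (t + max x 0)) ∂expMeasure 1 := by
  rw [restrict_Ioi_logQuantile hF hlt ht, integral_smul_measure,
    integral_map (measurable_logQuantile_add_max hF ht).aemeasurable hf.aestronglyMeasurable,
    ENNReal.toReal_ofReal (Real.exp_pos _).le]

theorem integrableOn_Ioi_logQuantile [IsProbabilityMeasure μ]
    (hF : Continuous (cdf μ)) (hlt : ∀ y, cdf μ y < 1) {t : ℝ}
    (ht : 0 < t) {f : ℝ → ℝ} (hf : Measurable f)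
    (hi : Integrable (fun x => f (logQuantile μ (t + max x 0))) (expMeasure 1)) :
    IntegrableOn f (Set.Ioi (logQuantile μ t)) μ := by
  rw [IntegrableOn, restrict_Ioi_logQuantile hF hlt ht]
  refine Integrable.smul_measure ?_ ENNReal.ofReal_ne_top
  rw [integrable_map_measure hf.aestronglyMeasurable
    (measurable_logQuantile_add_max hF ht).aemeasurable]
  exact hi

/-- The normalized excess over a high quantile, as a function of an exponential variable. -/
noncomputable def excess (μ : Measure ℝ) (t x : ℝ) : ℝ :=
  (logQuantile μ (t + max x 0) - logQuantile μ t) / logScale μ t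

variable {ρ : ℝ}

theorem IsLogExpPowerLaw.excess_bounds (hμ : IsLogExpPowerLaw μ ρ) :
    ∀ᶠ t in atTop, 0 < t ∧ 0 < logScale μ t ∧ ∀ x, 0 ≤ excess μ t x ∧ excess μ t x ≤ 3 * |x| := by
  filter_upwards [hμ.logQuantile_sub_le] with t ⟨ht, ha, h⟩
  refine ⟨ht, ha, fun x => ?_⟩
  obtain ⟨h1, h2⟩ := h (max x 0) (le_max_right _ _)
  refine ⟨div_nonneg h1 ha.le, ?_⟩
  rw [excess, div_le_iff₀ ha]
  refine h2.trans ?_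
  have : max x 0 ≤ |x| := max_le (le_abs_self x) (abs_nonneg x)
  gcongr

theorem measurable_excess (hF : Continuous (cdf μ)) {t : ℝ} (ht : 0 < t) :
    Measurable (excess μ t) :=
  ((measurable_logQuantile_add_max hF ht).sub_const _).div_const _

theorem IsLogExpPowerLaw.tendsto_excess (hμ : IsLogExpPowerLaw μ ρ) {x : ℝ} (hx : 0 < x) :
    Tendsto (fun t => excess μ t x) atTop (𝓝 x) := by
  have := hμ.tendsto_increment x
  unfold excess
  rwa [max_eq_left hx.le]

theorem IsLogExpPowerLaw.tendsto_integral_excess (hμ : IsLogExpPowerLaw μ ρ) :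
    Tendsto (fun t => ∫ x, excess μ t x ∂expMeasure 1) atTop (𝓝 1) := by
  have h1 := integral_pow_expMeasure 1
  have h2 := integrable_pow_expMeasure 1
  simp only [pow_one, Nat.factorial_one, Nat.cast_one] at h1 h2
  suffices Tendsto (fun t => ∫ x, excess μ t x ∂expMeasure 1) atTop
      (𝓝 (∫ x, x ∂expMeasure 1)) by rwa [h1] at this
  refine tendsto_integral_filter_of_dominated_convergence (fun x => 3 * |x|) ?_ ?_
    (h2.abs.const_mul 3) ?_
  · filter_upwards [eventually_gt_atTop 0] with t ht
    exact (measurable_excess hμ.continuous_cdf ht).aestronglyMeasurable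
  · filter_upwards [hμ.excess_bounds] with t ⟨_, _, h⟩
    refine Eventually.of_forall fun x => ?_
    rw [Real.norm_eq_abs, abs_of_nonneg (h x).1]
    exact (h x).2
  · filter_upwards [ae_expMeasure_pos] with x hx using hμ.tendsto_excess hx

theorem IsLogExpPowerLaw.tendsto_integral_excess_sub_sq (hμ : IsLogExpPowerLaw μ ρ) :
    Tendsto (fun t => ∫ x, (excess μ t x - x) ^ 2 ∂expMeasure 1) atTop (𝓝 0) := by
  suffices Tendsto (fun t => ∫ x, (excess μ t x - x) ^ 2 ∂expMeasure 1) atTop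
      (𝓝 (∫ _, (0:ℝ) ∂expMeasure 1)) by simpa using this
  -- The dominating constant is `(3 + 1)^2`, from `|excess| ≤ 3|x|`.
  refine tendsto_integral_filter_of_dominated_convergence (fun x => 16 * x ^ 2) ?_ ?_
    ((integrable_pow_expMeasure 2).const_mul 16) ?_
  · filter_upwards [eventually_gt_atTop 0] with t ht
    have := measurable_excess hμ.continuous_cdf ht
    exact Measurable.aestronglyMeasurable (by fun_prop)
  · filter_upwards [hμ.excess_bounds] with t ⟨_, _, h⟩
    refine Eventually.of_forall fun x => ?_
    rw [Real.norm_eq_abs, abs_of_nonneg (sq_nonneg _), ← sq_abs x]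
    have h1 := h x
    have h2 := le_abs_self x
    have h3 := neg_abs_le x
    nlinarith
  · filter_upwards [ae_expMeasure_pos] with x hx
    have := (hμ.tendsto_excess hx).sub_const x
    rw [sub_self] at this
    simpa using this.pow 2

end

theorem measureReal_le_add {Ω : Type*} [MeasurableSpace Ω] (P : Measure Ω) [IsFiniteMeasure P]
    {p q r : Ω → Prop} (h : ∀ ω, p ω → q ω ∨ r ω) :
    P.real {ω | p ω} ≤ P.real {ω | q ω} + P.real {ω | r ω} :=
  (measureReal_mono h).trans (measureReal_union_le _ _)

/-! ### Stochastic boundedness and Ghosh's criterion. -/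

section InProbability

variable {Ω : ℕ → Type*} [∀ n, MeasurableSpace (Ω n)] {P : ∀ n, Measure (Ω n)}
  {X Y Z W : ∀ n, Ω n → ℝ}

/-- Convergence to `0` in probability, on varying probability spaces. -/
def VanishesInProbability (P : ∀ n, Measure (Ω n)) (X : ∀ n, Ω n → ℝ) : Prop :=
  ∀ ε > 0, Tendsto (fun n => (P n).real {ω | ε ≤ |X n ω|}) atTop (𝓝 0)

/-- Boundedness in probability, on varying probability spaces. -/
def BoundedInProbability (P : ∀ n, Measure (Ω n)) (X : ∀ n, Ω n → ℝ) : Prop :=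
  ∀ η > 0, ∃ K > 0, ∀ᶠ n in atTop, (P n).real {ω | K ≤ |X n ω|} ≤ η

theorem VanishesInProbability.of_le [∀ n, IsProbabilityMeasure (P n)]
    (hY : VanishesInProbability P Y)
    (h : ∀ᶠ n in atTop, ∀ ω, |X n ω| ≤ |Y n ω|) : VanishesInProbability P X := by
  intro ε hε
  refine squeeze_zero' (Eventually.of_forall fun n => measureReal_nonneg) ?_ (hY ε hε)
  filter_upwards [h] with n hn
  exact measureReal_mono fun ω hω => le_trans hω (hn ω)

theorem VanishesInProbability.add [∀ n, IsProbabilityMeasure (P n)]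
    (hX : VanishesInProbability P X)
    (hY : VanishesInProbability P Y) : VanishesInProbability P fun n ω => X n ω + Y n ω := by
  intro ε hε
  have := (hX (ε / 2) (by positivity)).add (hY (ε / 2) (by positivity))
  rw [add_zero] at this
  refine squeeze_zero (fun n => measureReal_nonneg) (fun n => ?_) this
  refine measureReal_le_add _ fun ω hω => ?_
  by_contra! hcon
  have := abs_add_le (X n ω) (Y n ω)
  linarith

theorem vanishesInProbability_const {c : ℕ → ℝ} (hc : Tendsto c atTop (𝓝 0)) :
    VanishesInProbability P fun n _ => c n := by
  intro ε hε
  refine tendsto_const_nhds.congr' ?_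
  have h := hc.abs
  rw [abs_zero] at h
  filter_upwards [h.eventually (gt_mem_nhds hε)] with n hn
  simp [not_le.2 hn]

theorem VanishesInProbability.mul [∀ n, IsProbabilityMeasure (P n)]
    (hX : VanishesInProbability P X)
    (hY : BoundedInProbability P Y) : VanishesInProbability P fun n ω => X n ω * Y n ω := by
  intro ε hε
  rw [Metric.tendsto_nhds]
  intro η hη
  obtain ⟨K, hK, h⟩ := hY (η / 2) (by positivity)
  filter_upwards [h, (hX (ε / K) (by positivity)).eventually
    (gt_mem_nhds (show (0:ℝ) < η / 2 by positivity))] with n h1 h2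
  rw [Real.dist_eq, sub_zero, abs_of_nonneg measureReal_nonneg]
  refine lt_of_le_of_lt (measureReal_le_add (P n) (q := fun ω => K ≤ |Y n ω|)
    (r := fun ω => ε / K ≤ |X n ω|) fun ω hω => ?_) (by linarith)
  by_contra! hcon
  rw [abs_mul] at hω
  have : |X n ω| * |Y n ω| < ε / K * K :=
    mul_lt_mul'' hcon.2 hcon.1 (abs_nonneg _) (abs_nonneg _)
  rw [div_mul_cancel₀ _ hK.ne'] at this
  linarith

theorem BoundedInProbability.add_vanishes [∀ n, IsProbabilityMeasure (P n)]
    (hY : BoundedInProbability P Y)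
    (hX : VanishesInProbability P X) : BoundedInProbability P fun n ω => Y n ω + X n ω := by
  intro η hη
  obtain ⟨K, hK, h⟩ := hY (η / 2) (by positivity)
  refine ⟨K + 1, by positivity, ?_⟩
  filter_upwards [h, (hX 1 one_pos).eventually
    (gt_mem_nhds (show (0:ℝ) < η / 2 by positivity))] with n h1 h2
  refine (measureReal_le_add (P n) (q := fun ω => K ≤ |Y n ω|)
    (r := fun ω => 1 ≤ |X n ω|) fun ω hω => ?_).trans (by linarith)
  by_contra! hcon
  have := abs_add_le (Y n ω) (X n ω)
  linarith

theorem boundedInProbability_const {c : ℕ → ℝ} {l : ℝ} (hc : Tendsto c atTop (𝓝 l)) :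
    BoundedInProbability P fun n _ => c n := by
  intro η hη
  refine ⟨|l| + 1, by positivity, ?_⟩
  filter_upwards [hc.abs.eventually (gt_mem_nhds (show |l| < |l| + 1 by linarith))] with n hn
  simp [not_le.2 hn, hη.le]

/-- Ghosh's criterion: two sequences that cannot be separated by any level are asymptotically
equal. -/
theorem vanishesInProbability_sub_of_levels [∀ n, IsProbabilityMeasure (P n)]
    (hZ : BoundedInProbability P Z)
    (h1 : ∀ x : ℝ, ∀ δ > 0,
      Tendsto (fun n => (P n).real {ω | x + δ ≤ W n ω ∧ Z n ω ≤ x}) atTop (𝓝 0))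
    (h2 : ∀ x : ℝ, ∀ δ > 0,
      Tendsto (fun n => (P n).real {ω | W n ω ≤ x ∧ x + δ ≤ Z n ω}) atTop (𝓝 0)) :
    VanishesInProbability P fun n ω => W n ω - Z n ω := by
  intro ε hε
  rw [Metric.tendsto_nhds]
  intro η hη
  obtain ⟨K, hK, hZK⟩ := hZ (η / 2) (by positivity)
  -- With mesh `ε / 2`, two values at distance `ε` are separated by a full cell of the grid. The
  -- margin `2` in `M` covers the cell below the floor used in the second case.
  set δ := ε / 2 with hδ
  have hδ0 : 0 < δ := by positivity
  set M : ℤ := ⌈K / δ⌉ + 2 with hM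
  set J : Finset ℤ := Finset.Icc (-M) M with hJ
  have hsum : Tendsto (fun n => ∑ j ∈ J, ((P n).real {ω | j * δ + δ ≤ W n ω ∧ Z n ω ≤ j * δ} +
      (P n).real {ω | W n ω ≤ j * δ ∧ j * δ + δ ≤ Z n ω})) atTop (𝓝 0) := by
    have := tendsto_finsetSum J fun j _ => (h1 (j * δ) δ hδ0).add (h2 (j * δ) δ hδ0)
    simpa using this
  filter_upwards [hZK, hsum.eventually (gt_mem_nhds (show (0:ℝ) < η / 2 by positivity))]
    with n hn1 hn2
  rw [Real.dist_eq, sub_zero, abs_of_nonneg measureReal_nonneg]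
  have hsub : {ω | ε ≤ |W n ω - Z n ω|} ⊆ {ω | K ≤ |Z n ω|} ∪
      ⋃ j ∈ J, ({ω | j * δ + δ ≤ W n ω ∧ Z n ω ≤ j * δ} ∪
        {ω | W n ω ≤ j * δ ∧ j * δ + δ ≤ Z n ω}) := by
    intro ω hω
    by_cases hKZ : K ≤ |Z n ω|
    · exact Or.inl hKZ
    right
    obtain ⟨g1, g2⟩ := abs_lt.1 (not_le.1 hKZ)
    have hKd : K / δ ≤ ⌈K / δ⌉ := Int.le_ceil _
    have g1' : -(K / δ) < Z n ω / δ := by rw [← neg_div]; gcongr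
    have g2' : Z n ω / δ < K / δ := by gcongr
    have hMr : (M : ℝ) = ⌈K / δ⌉ + 2 := by rw [hM]; push_cast; ring
    simp only [Set.mem_iUnion]
    rcases le_abs.1 (show ε ≤ |W n ω - Z n ω| from hω) with h | h
    · refine ⟨⌈Z n ω / δ⌉, ?_, Or.inl ⟨?_, ?_⟩⟩
      · have c1 := Int.le_ceil (Z n ω / δ)
        have c2 := Int.ceil_lt_add_one (Z n ω / δ)
        rw [hJ, Finset.mem_Icc]
        constructor <;> rify <;> linarith
      · have c2 := Int.ceil_lt_add_one (Z n ω / δ)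
        have : ⌈Z n ω / δ⌉ * δ < (Z n ω / δ + 1) * δ := by gcongr
        rw [add_mul, div_mul_cancel₀ _ hδ0.ne'] at this
        linarith
      · exact (div_le_iff₀ hδ0).1 (Int.le_ceil _)
    · refine ⟨⌊Z n ω / δ⌋ - 1, ?_, Or.inr ⟨?_, ?_⟩⟩
      · have c1 := Int.floor_le (Z n ω / δ)
        have c2 := Int.lt_floor_add_one (Z n ω / δ)
        rw [hJ, Finset.mem_Icc]
        constructor <;> rify <;> linarith
      · have c2 := Int.lt_floor_add_one (Z n ω / δ)
        have : (Z n ω / δ) * δ < (⌊Z n ω / δ⌋ + 1) * δ := by gcongr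
        rw [div_mul_cancel₀ _ hδ0.ne'] at this
        push_cast
        linarith
      · have := (le_div_iff₀ hδ0).1 (Int.floor_le (Z n ω / δ))
        push_cast
        linarith
  calc (P n).real {ω | ε ≤ |W n ω - Z n ω|}
      ≤ (P n).real {ω | K ≤ |Z n ω|} + ∑ j ∈ J,
        ((P n).real {ω | j * δ + δ ≤ W n ω ∧ Z n ω ≤ j * δ} +
          (P n).real {ω | W n ω ≤ j * δ ∧ j * δ + δ ≤ Z n ω}) := by
        refine (measureReal_mono hsub).trans ((measureReal_union_le _ _).trans ?_)
        gcongr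
        refine (measureReal_biUnion_finset_le _ _).trans ?_
        gcongr
        exact measureReal_union_le _ _
    _ < η := by linarith

end InProbability

/-! ### Exceedance indicators. -/

section Threshold

/-- The indicator of `(v, ∞)`. -/
noncomputable def exceedance (v y : ℝ) : ℝ := if v < y then 1 else 0

theorem measurable_exceedance (v : ℝ) : Measurable (exceedance v) :=
  Measurable.ite measurableSet_Ioi measurable_const measurable_const

theorem exceedance_eq_indicator (v : ℝ) : exceedance v = (Set.Ioi v).indicator fun _ => 1 := by
  ext y
  simp [exceedance, Set.indicator_apply]

theorem exceedance_anti {v w : ℝ} (h : v ≤ w) (y : ℝ) : exceedance w y ≤ exceedance v y := by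
  unfold exceedance
  split_ifs <;> linarith

variable {μ : Measure ℝ} [IsProbabilityMeasure μ]

theorem memLp_exceedance (v : ℝ) (p : ENNReal) : MemLp (exceedance v) p μ := by
  rw [exceedance_eq_indicator]
  exact (memLp_const 1).indicator measurableSet_Ioi

theorem integral_exceedance (hF : Continuous (cdf μ)) {t : ℝ} (ht : 0 < t) :
    ∫ y, exceedance (logQuantile μ t) y ∂μ = Real.exp (-t) := by
  rw [exceedance_eq_indicator, integral_indicator_const _ measurableSet_Ioi,
    measure_Ioi_logQuantile hF ht]
  simp

theorem integral_exceedance_sq (hF : Continuous (cdf μ)) {t : ℝ} (ht : 0 < t) :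
    ∫ y, exceedance (logQuantile μ t) y ^ 2 ∂μ = Real.exp (-t) := by
  rw [← integral_exceedance hF ht]
  congr 1 with y
  unfold exceedance
  split_ifs <;> simp

/-- The events are nested, so the difference of the indicators is, up to sign, an indicator, equal
to its own square. -/
theorem integral_exceedance_sub_sq (hF : Continuous (cdf μ)) {s t : ℝ} (hs : 0 < s) (ht : 0 < t) :
    ∫ y, (exceedance (logQuantile μ s) y - exceedance (logQuantile μ t) y) ^ 2 ∂μ =
      |Real.exp (-s) - Real.exp (-t)| := by
  have hi : ∀ v, Integrable (exceedance v) μ := fun v => (memLp_exceedance v 1).integrable le_rfl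
  wlog hst : s ≤ t generalizing s t with H
  · rw [abs_sub_comm, ← H ht hs (not_le.1 hst).le]
    congr 1 with y
    ring
  have : ∀ y, (exceedance (logQuantile μ s) y - exceedance (logQuantile μ t) y) ^ 2 =
      exceedance (logQuantile μ s) y - exceedance (logQuantile μ t) y := by
    intro y
    have := exceedance_anti (logQuantile_mono hF hs hst) y
    unfold exceedance at *
    split_ifs at * <;> norm_num at *
  simp only [this]
  rw [integral_sub (hi _) (hi _), integral_exceedance hF hs, integral_exceedance hF ht,
    abs_of_nonneg]
  have := Real.exp_le_exp.2 (neg_le_neg hst)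
  linarith

end Threshold

/-! ### Bahadur representation of intermediate order statistics. -/

/-- Dictionary between levels: a shift of `x / √k` on the logarithmic scale is a shift of about `x a
/ √k` in the observations. -/
theorem IsLogExpPowerLaw.tendsto_level {μ : Measure ℝ} {ρ : ℝ} {k : ℕ → ℕ} {t : ℕ → ℝ}
    (hμ : IsLogExpPowerLaw μ ρ) (hk : Tendsto k atTop atTop)
    (ht : Tendsto t atTop atTop) (x : ℝ) :
    Tendsto (fun n => √(k n : ℝ) * (logQuantile μ (t n + x / √(k n : ℝ)) - logQuantile μ (t n)) /
      logScale μ (t n)) atTop (𝓝 x) := by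
  have hs : Tendsto (fun n => √(k n : ℝ)) atTop atTop :=
    Real.tendsto_sqrt_atTop.comp (tendsto_natCast_atTop_atTop.comp hk)
  rw [Metric.tendsto_nhds]
  intro ε hε
  have hM : 0 < |x| + 1 := by positivity
  filter_upwards [ht.eventually (hμ.abs_logQuantile_sub_le (ε := ε / (|x| + 1)) (by positivity) hM),
    hs.eventually_ge_atTop 1] with n ⟨ha, h⟩ hsn
  have hs0 : 0 < √(k n : ℝ) := by linarith
  have hx1 : |x / √(k n : ℝ)| ≤ |x| + 1 := by
    rw [abs_div, abs_of_pos hs0]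
    have := div_le_self (abs_nonneg x) hsn
    linarith
  have h1 := h _ hx1
  rw [Real.dist_eq]
  have e1 : √(k n : ℝ) * (logQuantile μ (t n + x / √(k n : ℝ)) - logQuantile μ (t n)) /
      logScale μ (t n) - x = √(k n : ℝ) * (logQuantile μ (t n + x / √(k n : ℝ)) -
        logQuantile μ (t n) - x / √(k n : ℝ) * logScale μ (t n)) / logScale μ (t n) := by
    field_simp
  rw [e1, abs_div, abs_mul, abs_of_pos ha, abs_of_pos hs0, div_lt_iff₀ ha]
  calc √(k n : ℝ) * _ ≤ √(k n : ℝ) * (ε / (|x| + 1) * (|x / √(k n : ℝ)| * logScale μ (t n))) := by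
        gcongr
    _ = ε * (|x| / (|x| + 1)) * logScale μ (t n) := by
        rw [abs_div, abs_of_pos hs0]
        field_simp
    _ < ε * 1 * logScale μ (t n) := by
        gcongr
        rw [div_lt_one hM]
        linarith
    _ = ε * logScale μ (t n) := by ring

/-- The standardized number of observations above the level `logQuantile μ s`, where `c` is its
expectation and `k` the order of its variance. -/
noncomputable def exceedanceDeviation {Ω : Type*} (μ : Measure ℝ) (Y : ℕ → Ω → ℝ) (n k : ℕ) (s c : ℝ)
    (ω : Ω) : ℝ :=
  (∑ i : Fin n, exceedance (logQuantile μ s) (Y i ω) - c) / √(k : ℝ)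

/-- The standardized intermediate order statistic. -/
noncomputable def orderDeviation {Ω : Type*} (μ : Measure ℝ) (Y : ℕ → Ω → ℝ) (n k : ℕ) (t : ℝ) (ω : Ω) : ℝ :=
  √(k : ℝ) * (descOrderStat (fun j : Fin n => Y j ω) (k - 1) - logQuantile μ t) / logScale μ t

section Intermediate

variable {Ω : Type*} [MeasurableSpace Ω] {P : Measure Ω} [IsProbabilityMeasure P]
  {Y : ℕ → Ω → ℝ} {μ : Measure ℝ} [IsProbabilityMeasure μ] {ρ : ℝ} {k : ℕ → ℕ} {t : ℕ → ℝ}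

theorem measureReal_exceedanceDeviation_sub_le (hF : Continuous (cdf μ))
    (hlaw : ∀ i, HasLaw (Y i) μ P) (hindep : iIndepFun Y P) {n k : ℕ} (hk : 0 < k) {s t : ℝ}
    (hs : 0 < s) (ht : 0 < t) {δ : ℝ} (hδ : 0 < δ) :
    P.real {ω | δ ≤ |exceedanceDeviation μ Y n k s (n * Real.exp (-s)) ω -
      exceedanceDeviation μ Y n k t (n * Real.exp (-t)) ω|} ≤
    |n * Real.exp (-s) - n * Real.exp (-t)| / k / δ ^ 2 := by
  have hk' : (0:ℝ) < k := by exact_mod_cast hk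
  have hsk : 0 < √(k : ℝ) := Real.sqrt_pos.2 hk'
  have hi : ∀ v, Integrable (exceedance v) μ := fun v => (memLp_exceedance v 1).integrable le_rfl
  have h := measureReal_sum_ge_le hlaw hindep
    (g := fun y => exceedance (logQuantile μ s) y - exceedance (logQuantile μ t) y)
    ((measurable_exceedance _).sub (measurable_exceedance _))
    ((memLp_exceedance _ 2).sub (memLp_exceedance _ 2)) n (c := δ * √k) (by positivity)
  rw [integral_exceedance_sub_sq hF hs ht, integral_sub (hi _) (hi _), integral_exceedance hF hs,
    integral_exceedance hF ht, mul_pow, Real.sq_sqrt hk'.le] at h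
  refine le_trans (measureReal_mono fun ω hω => ?_) (h.trans_eq ?_)
  · simp only [Set.mem_ofPred_eq, exceedanceDeviation] at hω ⊢
    rw [← sub_div, abs_div, abs_of_pos hsk, le_div_iff₀ hsk] at hω
    refine hω.trans_eq ?_
    congr 1
    rw [Finset.sum_sub_distrib]
    ring
  · rw [← mul_sub, abs_mul, Nat.abs_cast]
    field_simp

theorem boundedInProbability_exceedanceDeviation (hF : Continuous (cdf μ))
    (hlaw : ∀ i, HasLaw (Y i) μ P) (hindep : iIndepFun Y P) (hk : Tendsto k atTop atTop)
    (ht : Tendsto t atTop atTop) (hnt : ∀ᶠ n : ℕ in atTop, n * Real.exp (-t n) = k n) :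
    BoundedInProbability (fun _ => P) fun n => exceedanceDeviation μ Y n (k n) (t n) (k n) := by
  intro η hη
  refine ⟨√(1 / η), by positivity, ?_⟩
  filter_upwards [hk.eventually_gt_atTop 0, ht.eventually_gt_atTop 0, hnt] with n hkn htn hn
  have hk' : (0:ℝ) < k n := by exact_mod_cast hkn
  have hsk : 0 < √(k n : ℝ) := Real.sqrt_pos.2 hk'
  have h := measureReal_sum_ge_le hlaw hindep (measurable_exceedance (logQuantile μ (t n)))
    (memLp_exceedance _ 2) n (c := √(1 / η) * √(k n)) (by positivity)
  rw [integral_exceedance_sq hF htn, integral_exceedance hF htn, hn, mul_pow,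
    Real.sq_sqrt hk'.le, Real.sq_sqrt (by positivity)] at h
  refine le_trans (measureReal_mono fun ω hω => ?_) (h.trans_eq ?_)
  · simp only [Set.mem_ofPred_eq, exceedanceDeviation] at hω ⊢
    rwa [abs_div, abs_of_pos hsk, le_div_iff₀ hsk] at hω
  · field_simp

/-- The drift `(k - k e^{-x/√k}) / √k` of the expected count under a shift of the level; its limit
is a derivative at `0`. -/
theorem tendsto_sqrt_mul_one_sub_exp (hk : Tendsto k atTop atTop) (x : ℝ) :
    Tendsto (fun n => √(k n : ℝ) * (1 - Real.exp (-(x / √(k n : ℝ))))) atTop (𝓝 x) := by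
  have hs : Tendsto (fun n => √(k n : ℝ)) atTop atTop :=
    Real.tendsto_sqrt_atTop.comp (tendsto_natCast_atTop_atTop.comp hk)
  rcases eq_or_ne x 0 with rfl | hx
  · simp
  have hd : HasDerivAt (fun y : ℝ => 1 - Real.exp (-y)) 1 0 := by
    have h := ((hasDerivAt_neg (0:ℝ)).exp).const_sub 1
    simpa using h
  have hlim := hasDerivAt_iff_tendsto_slope.1 hd
  have h0 : Tendsto (fun n => x / √(k n : ℝ)) atTop (𝓝[≠] 0) := by
    refine tendsto_nhdsWithin_iff.2 ⟨tendsto_const_nhds.div_atTop hs, ?_⟩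
    filter_upwards [hs.eventually_gt_atTop 0] with n hn
    simp [hx, hn.ne']
  have := (hlim.comp h0).const_mul x
  rw [mul_one] at this
  refine this.congr' ?_
  filter_upwards [hs.eventually_gt_atTop 0] with n hn
  simp only [Function.comp, slope_def_field]
  field_simp
  simp only [sub_zero, neg_zero, Real.exp_zero, sub_self, mul_zero]
  exact mul_div_cancel_left₀ _ hx

theorem tendsto_shift (hk : Tendsto k atTop atTop) (ht : Tendsto t atTop atTop) (x : ℝ) :
    Tendsto (fun n => t n + x / √(k n : ℝ)) atTop atTop := by
  have hs : Tendsto (fun n => √(k n : ℝ)) atTop atTop :=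
    Real.tendsto_sqrt_atTop.comp (tendsto_natCast_atTop_atTop.comp hk)
  exact ht.atTop_add (tendsto_const_nhds (x := x).div_atTop hs)

/-- Stochastic equicontinuity: the variance of the change in the count is at most the change `k
|e^{-x/√k} - 1|` in its mean, which is `o(k)`. -/
theorem vanishesInProbability_exceedanceDeviation_shift (hF : Continuous (cdf μ))
    (hlaw : ∀ i, HasLaw (Y i) μ P) (hindep : iIndepFun Y P) (hk : Tendsto k atTop atTop)
    (ht : Tendsto t atTop atTop) (hnt : ∀ᶠ n : ℕ in atTop, n * Real.exp (-t n) = k n) (x : ℝ) :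
    VanishesInProbability (fun _ => P) fun n ω =>
      exceedanceDeviation μ Y n (k n) (t n + x / √(k n : ℝ))
        (k n * Real.exp (-(x / √(k n : ℝ)))) ω -
      exceedanceDeviation μ Y n (k n) (t n) (k n) ω := by
  intro δ hδ
  have hs : Tendsto (fun n => √(k n : ℝ)) atTop atTop :=
    Real.tendsto_sqrt_atTop.comp (tendsto_natCast_atTop_atTop.comp hk)
  have hlim : Tendsto (fun n => |Real.exp (-(x / √(k n : ℝ))) - 1| / δ ^ 2) atTop (𝓝 0) := by
    have h1 : Tendsto (fun n => Real.exp (-(x / √(k n : ℝ)))) atTop (𝓝 (Real.exp (-0))) :=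
      (Real.continuous_exp.tendsto _).comp ((tendsto_const_nhds (x := x).div_atTop hs).neg)
    have h2 := ((h1.sub_const 1).abs).div_const (δ ^ 2)
    simpa using h2
  refine squeeze_zero' (Eventually.of_forall fun n => measureReal_nonneg) ?_ hlim
  filter_upwards [hk.eventually_gt_atTop 0, ht.eventually_gt_atTop 0, hnt,
    (tendsto_shift hk ht x).eventually_gt_atTop 0] with n hkn htn hn hxn
  have h := measureReal_exceedanceDeviation_sub_le hF hlaw hindep (n := n) hkn hxn htn hδ
  have e1 : (n : ℝ) * Real.exp (-(t n + x / √(k n : ℝ))) = k n * Real.exp (-(x / √(k n : ℝ))) := by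
    rw [neg_add, Real.exp_add, ← mul_assoc, hn]
  rw [e1, hn] at h
  have hk' : (0:ℝ) < k n := by exact_mod_cast hkn
  refine h.trans_eq ?_
  rw [show (k n : ℝ) * Real.exp (-(x / √(k n : ℝ))) - k n =
    k n * (Real.exp (-(x / √(k n : ℝ))) - 1) by ring, abs_mul, abs_of_pos hk']
  field_simp

theorem lt_descOrderStat_iff_le_sum {n k : ℕ} (hk : 0 < k) (hkn : k ≤ n) (x : Fin n → ℝ) (v : ℝ) :
    v < descOrderStat x (k - 1) ↔ (k : ℝ) ≤ ∑ i, exceedance v (x i) := by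
  have h := lt_descOrderStat_iff x ⟨k - 1, by omega⟩ v
  simp only at h
  rw [h, Nat.sub_add_cancel hk]
  unfold exceedance
  rw [Finset.sum_boole]
  norm_cast

/-- The Bahadur representation of intermediate order statistics. -/
theorem IsLogExpPowerLaw.vanishesInProbability_bahadur (hμ : IsLogExpPowerLaw μ ρ)
    (hlaw : ∀ i, HasLaw (Y i) μ P) (hindep : iIndepFun Y P) (hk : Tendsto k atTop atTop)
    (ht : Tendsto t atTop atTop) (hnt : ∀ᶠ n : ℕ in atTop, n * Real.exp (-t n) = k n)
    (hkn : ∀ᶠ n in atTop, k n < n) :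
    VanishesInProbability (fun _ => P) fun n ω => orderDeviation μ Y n (k n) (t n) ω -
      exceedanceDeviation μ Y n (k n) (t n) (k n) ω := by
  have hF := hμ.continuous_cdf
  have hpos : ∀ᶠ n in atTop, 0 < logScale μ (t n) := by
    filter_upwards [ht.eventually hμ.logQuantile_sub_le] with n hn using hn.2.1
  have e1 : ∀ (n : ℕ) (y : ℝ) (ω : Ω), 0 < k n →
      exceedanceDeviation μ Y n (k n) (t n + y / √(k n : ℝ)) (k n * Real.exp (-(y / √(k n : ℝ)))) ω
      = √(k n : ℝ) * (1 - Real.exp (-(y / √(k n : ℝ)))) +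
        (∑ i : Fin n, exceedance (logQuantile μ (t n + y / √(k n : ℝ))) (Y i ω) - k n) /
          √(k n : ℝ) := by
    intro n y ω hkn
    have hk' : (0:ℝ) < k n := by exact_mod_cast hkn
    have hsk : 0 < √(k n : ℝ) := Real.sqrt_pos.2 hk'
    rw [exceedanceDeviation]
    field_simp
    rw [Real.sq_sqrt hk'.le]
    ring
  -- The level `x + δ/2` is tested. Whether the order deviation exceeds it is decided by whether the
  -- count reaches `k`; by `e1` this puts the deviation of the shifted count above `x + δ/4`,
  -- respectively below `x + 3δ/4`. In either case it differs from the unshifted deviation by at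
  -- least `δ/4`.
  refine vanishesInProbability_sub_of_levels
    (boundedInProbability_exceedanceDeviation hF hlaw hindep hk ht hnt) ?_ ?_
  · intro x δ hδ
    have hsh := vanishesInProbability_exceedanceDeviation_shift hF hlaw hindep hk ht hnt
      (x + δ / 2) (δ / 4) (by positivity)
    refine squeeze_zero' (Eventually.of_forall fun n => measureReal_nonneg) ?_ hsh
    filter_upwards [(hμ.tendsto_level hk ht (x + δ / 2)).eventually
        (gt_mem_nhds (show x + δ / 2 < x + δ by linarith)),
      (tendsto_sqrt_mul_one_sub_exp hk (x + δ / 2)).eventually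
        (lt_mem_nhds (show x + δ / 4 < x + δ / 2 by linarith)),
      hpos, hk.eventually_gt_atTop 0, hkn] with n h1 h2 ha hk0 hkn'
    refine measureReal_mono fun ω ⟨hω1, hω2⟩ => ?_
    have hk' : (0:ℝ) < k n := by exact_mod_cast hk0
    have hsk : 0 < √(k n : ℝ) := Real.sqrt_pos.2 hk'
    have h3 := h1.trans_le hω1
    rw [orderDeviation, div_lt_div_iff_of_pos_right ha, mul_lt_mul_iff_right₀ hsk,
      sub_lt_sub_iff_right, lt_descOrderStat_iff_le_sum hk0 hkn'.le] at h3
    have h4 := e1 n (x + δ / 2) ω hk0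
    have h5 := div_nonneg (sub_nonneg.2 h3) hsk.le
    rw [Set.mem_ofPred_eq]
    refine le_trans ?_ (le_abs_self _)
    linarith
  · intro x δ hδ
    have hsh := vanishesInProbability_exceedanceDeviation_shift hF hlaw hindep hk ht hnt
      (x + δ / 2) (δ / 4) (by positivity)
    refine squeeze_zero' (Eventually.of_forall fun n => measureReal_nonneg) ?_ hsh
    filter_upwards [(hμ.tendsto_level hk ht (x + δ / 2)).eventually
        (lt_mem_nhds (show x < x + δ / 2 by linarith)),
      (tendsto_sqrt_mul_one_sub_exp hk (x + δ / 2)).eventually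
        (gt_mem_nhds (show x + δ / 2 < x + δ * (3 / 4) by linarith)),
      hpos, hk.eventually_gt_atTop 0, hkn] with n h1 h2 ha hk0 hkn'
    refine measureReal_mono fun ω ⟨hω1, hω2⟩ => ?_
    have hk' : (0:ℝ) < k n := by exact_mod_cast hk0
    have hsk : 0 < √(k n : ℝ) := Real.sqrt_pos.2 hk'
    have h3 := hω1.trans_lt h1
    rw [orderDeviation, div_lt_div_iff_of_pos_right ha, mul_lt_mul_iff_right₀ hsk,
      sub_lt_sub_iff_right] at h3
    have h3' := not_le.1 ((lt_descOrderStat_iff_le_sum hk0 hkn'.le _ _).not.1 h3.not_gt)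
    have h4 := e1 n (x + δ / 2) ω hk0
    have h5 := div_nonpos_of_nonpos_of_nonneg (sub_nonpos.2 h3'.le) hsk.le
    rw [Set.mem_ofPred_eq]
    refine le_trans ?_ (neg_le_abs _)
    linarith

end Intermediate

/-! ### Growth of `ζ(1; k - 1) - γ`. -/

theorem tendsto_zetaGap_sub_log {k : ℕ → ℕ} (hk : Tendsto k atTop atTop) :
    Tendsto (fun n => zetaGap (k n) - Real.log ((k n : ℝ) - 1)) atTop (𝓝 0) := by
  have h1 : Tendsto (fun n => k n - 1) atTop atTop := (tendsto_sub_atTop_nat 1).comp hk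
  have h2 := (Real.tendsto_harmonic_sub_log.comp h1).sub_const Real.eulerMascheroniConstant
  rw [sub_self] at h2
  refine h2.congr' ?_
  filter_upwards [hk.eventually_ge_atTop 1] with n hn
  simp only [Function.comp, zetaGap, Nat.cast_sub hn, Nat.cast_one]
  ring

theorem tendsto_pred_atTop {k : ℕ → ℕ} (hk : Tendsto k atTop atTop) :
    Tendsto (fun n => (k n : ℝ) - 1) atTop atTop :=
  tendsto_atTop_add_const_right _ (-1) (tendsto_natCast_atTop_atTop.comp hk)

theorem tendsto_zetaGap {k : ℕ → ℕ} (hk : Tendsto k atTop atTop) :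
    Tendsto (fun n => zetaGap (k n)) atTop atTop := by
  have h2 := Real.tendsto_log_atTop.comp (tendsto_pred_atTop hk)
  refine (h2.atTop_add (tendsto_zetaGap_sub_log hk)).congr fun n => ?_
  simp

theorem tendsto_div_pred {k : ℕ → ℕ} (hk : Tendsto k atTop atTop) :
    Tendsto (fun n => (k n : ℝ) / ((k n : ℝ) - 1)) atTop (𝓝 1) := by
  have h := (tendsto_const_nhds (x := (1:ℝ))).div_atTop (tendsto_pred_atTop hk)
  have h2 := h.const_add 1
  rw [add_zero] at h2
  refine h2.congr' ?_
  filter_upwards [hk.eventually_ge_atTop 2] with n hn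
  have : (2:ℝ) ≤ k n := by exact_mod_cast hn
  have : (k n : ℝ) - 1 ≠ 0 := by linarith
  field_simp
  ring

/-! ### Central limit theorem for the exponential excesses. -/

section Intermediate

variable {Ω : Type*} [MeasurableSpace Ω] {P : Measure Ω}
  {Y : ℕ → Ω → ℝ} {μ : Measure ℝ} {ρ : ℝ} {k : ℕ → ℕ} {t : ℕ → ℝ}

/-- The centred exponential excess of the cumulative hazard over the level `t`. -/
noncomputable def hazardExcess (μ : Measure ℝ) (t y : ℝ) : ℝ :=
  exceedance (logQuantile μ t) y * (hazard μ y - t - 1)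

/-- The difference between the normalized excess and the exponential excess. -/
noncomputable def excessError (μ : Measure ℝ) (t y : ℝ) : ℝ :=
  exceedance (logQuantile μ t) y *
    ((y - logQuantile μ t) / logScale μ t - (hazard μ y - t))

theorem measurable_hazardExcess (hF : Continuous (cdf μ)) (t : ℝ) :
    Measurable (hazardExcess μ t) :=
  (measurable_exceedance _).mul (((measurable_hazard hF).sub_const _).sub_const _)

theorem measurable_excessError (hF : Continuous (cdf μ)) (t : ℝ) :
    Measurable (excessError μ t) :=
  (measurable_exceedance _).mul
    (((measurable_id.sub_const _).div_const _).sub ((measurable_hazard hF).sub_const _))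

/-- The variable is `0` with probability `1 - e^{-t}` and otherwise a centred standard exponential.
-/
theorem charFun_hazardExcess [IsProbabilityMeasure μ] (hμ : IsLogExpPowerLaw μ ρ) {t : ℝ}
    (ht : 0 < t) (θ : ℝ) : charFun (μ.map (hazardExcess μ t)) θ =
      1 + Real.exp (-t) * (expCharFun θ - 1) := by
  have hF := hμ.continuous_cdf
  have hm := measurable_hazardExcess hF t
  have hmh := measurable_hazard hF
  set f : ℝ → ℂ := fun y => Complex.exp (θ * ((hazard μ y - t - 1 : ℝ) : ℂ) * Complex.I) - 1
  have hf : Measurable f := by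
    have : Measurable fun y => ((hazard μ y - t - 1 : ℝ) : ℂ) :=
      Complex.measurable_ofReal.comp ((hmh.sub_const _).sub_const _)
    exact (Complex.measurable_exp.comp ((this.const_mul _).mul_const _)).sub_const _
  have hnorm : ∀ y, ‖f y‖ ≤ 2 := fun y => by
    refine (norm_sub_le _ _).trans ?_
    rw [← Complex.ofReal_mul, Complex.norm_exp_ofReal_mul_I]
    norm_num
  have hfi : Integrable f μ :=
    Integrable.of_bound hf.aestronglyMeasurable 2 (Eventually.of_forall hnorm)
  have e1 : ∀ y, Complex.exp (θ * (hazardExcess μ t y : ℂ) * Complex.I) =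
      1 + (Set.Ioi (logQuantile μ t)).indicator f y := by
    intro y
    by_cases hy : logQuantile μ t < y
    · rw [Set.indicator_of_mem (Set.mem_Ioi.2 hy)]
      simp [f, hazardExcess, exceedance, hy]
    · rw [Set.indicator_of_notMem (by simpa using hy)]
      simp [hazardExcess, exceedance, hy]
  rw [charFun_apply_real, integral_map hm.aemeasurable (by fun_prop)]
  simp only [e1]
  rw [integral_add (integrable_const _) (hfi.indicator measurableSet_Ioi),
    integral_indicator measurableSet_Ioi,
    setIntegral_Ioi_logQuantile hF hμ.cdf_lt_one ht hf.stronglyMeasurable]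
  have e2 : ∫ x, f (logQuantile μ (t + max x 0)) ∂expMeasure 1 = expCharFun θ - 1 := by
    rw [expCharFun, charFun_apply_real, integral_map (by fun_prop) (by fun_prop)]
    have hi : Integrable (fun x : ℝ => Complex.exp (θ * ((x - 1 : ℝ) : ℂ) * Complex.I))
        (expMeasure 1) := by
      refine Integrable.of_bound (by fun_prop) 1 (Eventually.of_forall fun x => ?_)
      rw [← Complex.ofReal_mul, Complex.norm_exp_ofReal_mul_I]
    rw [show (1:ℂ) = ∫ _, (1:ℂ) ∂expMeasure 1 by simp, ← integral_sub hi (integrable_const _)]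
    refine integral_congr_ae ?_
    filter_upwards [ae_expMeasure_pos] with x hx
    simp only [f]
    rw [max_eq_left hx.le, hazard_logQuantile hF (by linarith), add_sub_cancel_left]
  rw [e2]
  simp

theorem excessError_logQuantile (hF : Continuous (cdf μ)) {t : ℝ} (ht : 0 < t) :
    ∀ᵐ x ∂expMeasure 1, excessError μ t (logQuantile μ (t + max x 0)) = excess μ t x - x := by
  filter_upwards [ae_expMeasure_pos] with x hx
  have h1 : logQuantile μ t < logQuantile μ (t + x) := by
    rw [lt_logQuantile_iff hF (by linarith), cdf_logQuantile hF ht]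
    have := Real.exp_lt_exp.2 (show -(t + x) < -t by linarith)
    linarith
  rw [excessError, excess, max_eq_left hx.le, hazard_logQuantile hF (by linarith), exceedance,
    if_pos h1]
  ring

theorem excessError_eq_indicator (t : ℝ) :
    excessError μ t = (Set.Ioi (logQuantile μ t)).indicator (excessError μ t) := by
  ext y
  by_cases hy : logQuantile μ t < y
  · rw [Set.indicator_of_mem (Set.mem_Ioi.2 hy)]
  · rw [Set.indicator_of_notMem (by simpa using hy)]
    simp [excessError, exceedance, hy]

theorem IsLogExpPowerLaw.memLp_excess (hμ : IsLogExpPowerLaw μ ρ) :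
    ∀ᶠ t in atTop, MemLp (fun x => excess μ t x - x) 2 (expMeasure 1) := by
  filter_upwards [hμ.excess_bounds] with t ⟨ht, _, h⟩
  have hm := measurable_excess hμ.continuous_cdf ht
  have h2 : MemLp (fun x : ℝ => 4 * x) 2 (expMeasure 1) := by
    refine MemLp.const_mul ?_ 4
    exact (memLp_two_iff_integrable_sq (by fun_prop)).2 (integrable_pow_expMeasure 2)
  refine h2.mono (hm.sub measurable_id).aestronglyMeasurable (Eventually.of_forall fun x => ?_)
  rw [Real.norm_eq_abs, Real.norm_eq_abs, abs_mul, abs_of_pos (show (0:ℝ) < 4 by norm_num), abs_le]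
  have h1 := h x
  have h2 := le_abs_self x
  have h3 := neg_abs_le x
  constructor <;> linarith

/-- Transfer to the exponential law: the second moment is `e^{-t}` times a quantity tending to `0`,
so the sum of `n` copies has variance `o(k)`. -/
theorem IsLogExpPowerLaw.excessError_moments [IsProbabilityMeasure μ]
    (hμ : IsLogExpPowerLaw μ ρ) :
    ∀ᶠ t in atTop, MemLp (excessError μ t) 2 μ ∧
      ∫ y, excessError μ t y ∂μ = Real.exp (-t) * (∫ x, excess μ t x ∂expMeasure 1 - 1) ∧
      ∫ y, excessError μ t y ^ 2 ∂μ =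
        Real.exp (-t) * ∫ x, (excess μ t x - x) ^ 2 ∂expMeasure 1 := by
  have hF := hμ.continuous_cdf
  have hlt := hμ.cdf_lt_one
  filter_upwards [hμ.memLp_excess, eventually_gt_atTop 0] with t hL ht
  have hm := measurable_excessError hF t
  have hae := excessError_logQuantile hF ht
  have hsq : (fun y => excessError μ t y ^ 2) =
      (Set.Ioi (logQuantile μ t)).indicator fun y => excessError μ t y ^ 2 := by
    ext y
    by_cases hy : logQuantile μ t < y
    · rw [Set.indicator_of_mem (Set.mem_Ioi.2 hy)]
    · rw [Set.indicator_of_notMem (by simpa using hy)]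
      simp [excessError, exceedance, hy]
  refine ⟨?_, ?_, ?_⟩
  · rw [memLp_two_iff_integrable_sq hm.aestronglyMeasurable, hsq,
      integrable_indicator_iff measurableSet_Ioi]
    refine integrableOn_Ioi_logQuantile hF hlt ht (hm.pow_const 2) ?_
    refine ((memLp_two_iff_integrable_sq hL.aestronglyMeasurable).1 hL).congr ?_
    filter_upwards [hae] with x hx
    rw [hx]
  · rw [excessError_eq_indicator, integral_indicator measurableSet_Ioi,
      setIntegral_Ioi_logQuantile hF hlt ht hm.stronglyMeasurable, smul_eq_mul,
      integral_congr_ae hae]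
    have h1 := integral_pow_expMeasure 1
    have h2 := integrable_pow_expMeasure 1
    simp only [pow_one, Nat.factorial_one, Nat.cast_one] at h1 h2
    have h3 : Integrable (fun x => excess μ t x) (expMeasure 1) := by
      have := (hL.integrable (by norm_num)).add h2
      refine this.congr (Eventually.of_forall fun x => ?_)
      simp
    rw [integral_sub h3 h2, h1]
  · rw [hsq, integral_indicator measurableSet_Ioi,
      setIntegral_Ioi_logQuantile hF hlt ht (hm.pow_const 2).stronglyMeasurable, smul_eq_mul]
    congr 1
    refine integral_congr_ae ?_
    filter_upwards [hae] with x hx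
    rw [hx]

/-- The characteristic function is `(1 + (k/n) (φ(θ/√(k-1)) - 1))^n`, and the second-order expansion
of `φ` at `0` gives the exponent `-θ²/2`, since `k / (k - 1) → 1`. -/
theorem IsLogExpPowerLaw.tendsto_charFun_sum_hazardExcess [IsProbabilityMeasure μ]
    (hμ : IsLogExpPowerLaw μ ρ)
    (hlaw : ∀ i, HasLaw (Y i) μ P) (hindep : iIndepFun Y P) (hk : Tendsto k atTop atTop)
    (ht : Tendsto t atTop atTop) (hnt : ∀ᶠ n : ℕ in atTop, n * Real.exp (-t n) = k n) (θ : ℝ) :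
    Tendsto (fun n => charFun (P.map fun ω =>
      (√((k n : ℝ) - 1))⁻¹ * ∑ i : Fin n, hazardExcess μ (t n) (Y i ω)) θ) atTop
      (𝓝 (Complex.exp (-θ ^ 2 / 2))) := by
  have hF := hμ.continuous_cdf
  have hs : Tendsto (fun n => √((k n : ℝ) - 1)) atTop atTop :=
    Real.tendsto_sqrt_atTop.comp (tendsto_pred_atTop hk)
  have hchar : ∀ᶠ n : ℕ in atTop, charFun (P.map fun ω =>
      (√((k n : ℝ) - 1))⁻¹ * ∑ i : Fin n, hazardExcess μ (t n) (Y i ω)) θ =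
      (1 + Real.exp (-t n) * (expCharFun ((√((k n : ℝ) - 1))⁻¹ * θ) - 1)) ^ n := by
    filter_upwards [ht.eventually_gt_atTop 0] with n htn
    have hm := measurable_hazardExcess hF (t n)
    have ham : ∀ i : Fin n, AEMeasurable (fun ω => hazardExcess μ (t n) (Y i ω)) P := fun i =>
      hm.comp_aemeasurable (hlaw i).aemeasurable
    have hind : iIndepFun (fun (i : Fin n) ω => hazardExcess μ (t n) (Y i ω)) P :=
      (hindep.precomp Fin.val_injective).comp (fun _ => hazardExcess μ (t n)) fun _ => hm
    rw [charFun_map_mul_comp (Finset.aemeasurable_fun_sum _ fun i _ => ham i),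
      hind.charFun_map_fun_sum_eq_prod ham]
    have : ∀ i : Fin n, P.map (fun ω => hazardExcess μ (t n) (Y i ω)) =
        μ.map (hazardExcess μ (t n)) := fun i => by
      have := AEMeasurable.map_map_of_aemeasurable (μ := P) (f := Y i) (g := hazardExcess μ (t n))
        hm.aemeasurable (hlaw i).aemeasurable
      rw [(hlaw i).map_eq] at this
      exact this.symm
    simp only [this, Finset.prod_const, Finset.card_univ, Fintype.card_fin, Pi.pow_apply]
    rw [charFun_hazardExcess hμ htn]
  refine Tendsto.congr' (hchar.mono fun n hn => hn.symm) ?_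
  apply Complex.tendsto_one_add_pow_exp_of_tendsto
  rcases eq_or_ne θ 0 with rfl | hθ
  · have h1 : expCharFun 0 = 1 := by
      have : IsProbabilityMeasure ((expMeasure 1).map fun x => x - 1) :=
        Measure.isProbabilityMeasure_map (by fun_prop)
      simp [expCharFun]
    simp [h1]
  have h0 : Tendsto (fun n => (√((k n : ℝ) - 1))⁻¹ * θ) atTop (𝓝 0) := by
    rw [← zero_mul θ]
    exact (tendsto_inv_atTop_zero.comp hs).mul_const θ
  have hlo := (isLittleO_expCharFun.comp_tendsto h0).tendsto_inv_smul_nhds_zero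
  have hkk : Tendsto (fun n => (((k n : ℝ) / ((k n : ℝ) - 1) : ℝ) : ℂ)) atTop (𝓝 1) := by
    exact (Complex.continuous_ofReal.tendsto _).comp (tendsto_div_pred hk)
  have hlim := hkk.mul ((hlo.const_mul ((θ : ℂ) ^ 2)).sub_const ((θ : ℂ) ^ 2 / 2))
  rw [mul_zero, zero_sub, one_mul, ← neg_div] at hlim
  refine hlim.congr' ?_
  filter_upwards [hnt, hk.eventually_ge_atTop 2] with n hn hkn
  have h2 : (2:ℝ) ≤ k n := by exact_mod_cast hkn
  have hm0 : (0:ℝ) < (k n : ℝ) - 1 := by linarith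
  have hsq := Real.sq_sqrt hm0.le
  have hs0 : √((k n : ℝ) - 1) ≠ 0 := (Real.sqrt_pos.2 hm0).ne'
  rw [← mul_assoc, show (n : ℂ) * (Real.exp (-t n) : ℂ) = ((k n : ℝ) : ℂ) by
    rw [← hn]; push_cast; rfl]
  have hs2 : ((√((k n : ℝ) - 1))⁻¹ * θ) ^ 2 = θ ^ 2 / ((k n : ℝ) - 1) := by
    rw [mul_pow, inv_pow, hsq]; field_simp
  simp only [Function.comp, ← Complex.ofReal_pow]
  rw [hs2, Complex.real_smul]
  have hθ' : (θ : ℂ) ≠ 0 := by exact_mod_cast hθ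
  have hmc : ((k n : ℝ) : ℂ) - 1 ≠ 0 := by
    have : (((k n : ℝ) - 1 : ℝ) : ℂ) ≠ 0 := by exact_mod_cast hm0.ne'
    simpa using this
  push_cast
  simp only [Complex.ofReal_natCast] at hmc
  field_simp
  ring

/-- The centring of `omegaSample`: the expectation of its linearization at the level `t`. -/
noncomputable def omegaCenter (μ : Measure ℝ) (k : ℕ) (t : ℝ) : ℝ :=
  logQuantile μ t + zetaGap k / ((k : ℝ) - 1) *
    (logScale μ t * (k * ∫ x, excess μ t x ∂expMeasure 1))

end Intermediate

/-! ### Linearization of the statistic. -/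

section Linearization

variable {Ω : Type*} {Y : ℕ → Ω → ℝ} {μ : Measure ℝ}

theorem max_sub_eq_exceedance {t : ℝ} (y : ℝ) (ha : 0 < logScale μ t) :
    max (y - logQuantile μ t) 0 = logScale μ t *
      (excessError μ t y + hazardExcess μ t y + exceedance (logQuantile μ t) y) := by
  unfold excessError hazardExcess exceedance
  split_ifs with h
  · rw [max_eq_left (by linarith)]
    field_simp
    ring
  · rw [max_eq_right (by linarith)]
    ring

theorem omegaSample_eq {n k : ℕ} (hk : 2 ≤ k) (hkn : k ≤ n) (ω : Ω) :
    omegaSample Y n k ω = descOrderStat (fun j : Fin n => Y j ω) (k - 1) +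
      zetaGap k / ((k : ℝ) - 1) *
        ∑ j : Fin n, max (Y j ω - descOrderStat (fun j : Fin n => Y j ω) (k - 1)) 0 := by
  obtain ⟨m, rfl⟩ : ∃ m, k = m + 1 := ⟨k - 1, by omega⟩
  have := omegaStat_descOrderStat (n := n) (m := m) (by omega) (by omega) fun j => Y j ω
  simpa [omegaSample] using this

/-- The four error terms are: the order statistic's own deviation, damped by `zetaGap`; the quantile
approximation error; the Bahadur remainder; and the product of deviations from moving the threshold.
-/
theorem abs_omegaSample_sub_le {n k : ℕ} (hk : 2 ≤ k) (hkn : k ≤ n) {t : ℝ}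
    (ha : 0 < logScale μ t) (hz : 0 < zetaGap k) (hn : n * Real.exp (-t) = k)
    (hE : ∫ y, excessError μ t y ∂μ = Real.exp (-t) * (∫ x, excess μ t x ∂expMeasure 1 - 1))
    (ω : Ω) :
    |(omegaSample Y n k ω - omegaCenter μ k t) / (logScale μ t * omegaScale k) -
      (√((k : ℝ) - 1))⁻¹ * ∑ i : Fin n, hazardExcess μ t (Y i ω)| ≤
    (√(k / ((k : ℝ) - 1)) * zetaGap k)⁻¹ * |orderDeviation μ Y n k t ω| +
    |(√((k : ℝ) - 1))⁻¹ * (∑ i : Fin n, excessError μ t (Y i ω) -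
      n * ∫ y, excessError μ t y ∂μ)| +
    √(k / ((k : ℝ) - 1)) *
      |orderDeviation μ Y n k t ω - exceedanceDeviation μ Y n k t k ω| +
    (√((k : ℝ) - 1))⁻¹ * |orderDeviation μ Y n k t ω| * |exceedanceDeviation μ Y n k t k ω| := by
  have h2 : (2:ℝ) ≤ k := by exact_mod_cast hk
  have hm0 : (0:ℝ) < (k : ℝ) - 1 := by linarith
  have hk0 : (0:ℝ) < k := by linarith
  have hdet := abs_sum_max_sub_le (m := k - 1) (by omega) (fun j : Fin n => Y j ω)
    (logQuantile μ t)
  rw [omegaSample_eq hk hkn, omegaCenter]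
  have hcast : ((k - 1 : ℕ) : ℝ) + 1 = k := by
    rw [Nat.cast_sub (by omega)]; simp
  have hcard : ((Finset.univ.filter fun j : Fin n => logQuantile μ t < Y j ω).card : ℝ) =
      ∑ i : Fin n, exceedance (logQuantile μ t) (Y i ω) := by
    unfold exceedance
    rw [Finset.sum_boole]
  rw [hcast, hcard] at hdet
  set T := descOrderStat (fun j : Fin n => Y j ω) (k - 1) with hT
  set u := logQuantile μ t with hu
  set a := logScale μ t with haa
  set N := ∑ i : Fin n, exceedance u (Y i ω) with hN
  set S := ∑ j : Fin n, max (Y j ω - T) 0 with hS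
  have hsum : ∑ j : Fin n, max (Y j ω - u) 0 = a * (∑ i : Fin n, excessError μ t (Y i ω) +
      ∑ i : Fin n, hazardExcess μ t (Y i ω) + N) := by
    rw [hN, ← Finset.sum_add_distrib, ← Finset.sum_add_distrib, Finset.mul_sum]
    exact Finset.sum_congr rfl fun i _ => max_sub_eq_exceedance _ ha
  rw [hsum] at hdet
  rw [hE, show (n : ℝ) * (Real.exp (-t) * (∫ x, excess μ t x ∂expMeasure 1 - 1)) =
    k * (∫ x, excess μ t x ∂expMeasure 1 - 1) by rw [← mul_assoc, hn]]
  set G := ∑ i : Fin n, excessError μ t (Y i ω)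
  set H := ∑ i : Fin n, hazardExcess μ t (Y i ω)
  set J := ∫ x, excess μ t x ∂expMeasure 1
  have hW : orderDeviation μ Y n k t ω = √(k : ℝ) * (T - u) / a := rfl
  have hZ : exceedanceDeviation μ Y n k t k ω = (N - k) / √(k : ℝ) := rfl
  rw [hW, hZ, omegaScale, Real.sqrt_div hk0.le]
  obtain ⟨s, hs0, hsk⟩ : ∃ s : ℝ, 0 < s ∧ √(k : ℝ) = s := ⟨_, Real.sqrt_pos.2 hk0, rfl⟩
  obtain ⟨r, hr0, hrk⟩ : ∃ r : ℝ, 0 < r ∧ √((k : ℝ) - 1) = r := ⟨_, Real.sqrt_pos.2 hm0, rfl⟩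
  have hs2 : (k : ℝ) = s ^ 2 := by rw [← hsk, Real.sq_sqrt hk0.le]
  have hr2 : (k : ℝ) - 1 = r ^ 2 := by rw [← hrk, Real.sq_sqrt hm0.le]
  rw [hsk, hrk, hr2, hs2]
  rw [hs2] at hdet
  set R := S - a * (G + H + N) + s ^ 2 * (T - u) with hR
  have hSR : S = R + a * (G + H + N) - s ^ 2 * (T - u) := by rw [hR]; ring
  -- Here `s = √k` and `r = √(k - 1)`. The count `N - k` and the threshold shift `-k (T - u) / a`
  -- meet in the third term, where they cancel asymptotically.
  have hident : (T + zetaGap k / r ^ 2 * S - (u + zetaGap k / r ^ 2 * (a * (s ^ 2 * J)))) /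
      (a * (zetaGap k / r)) - r⁻¹ * H =
      (s / r * zetaGap k)⁻¹ * (s * (T - u) / a) + r⁻¹ * (G - s ^ 2 * (J - 1)) +
      -(s / r * (s * (T - u) / a - (N - s ^ 2) / s)) + r⁻¹ * (R / a) := by
    rw [hSR]
    field_simp
    ring
  have hRa : |R / a| ≤ |s * (T - u) / a| * |(N - s ^ 2) / s| := by
    rw [abs_div, abs_of_pos ha, div_le_iff₀ ha]
    refine hdet.trans_eq ?_
    rw [← abs_mul, ← abs_mul, show s * (T - u) / a * ((N - s ^ 2) / s) =
      (T - u) * (N - s ^ 2) / a by field_simp, abs_div, abs_of_pos ha]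
    field_simp
  rw [hident]
  refine (abs_add_le _ _).trans (add_le_add ((abs_add_le _ _).trans (add_le_add
    ((abs_add_le _ _).trans (add_le_add ?_ le_rfl)) ?_)) ?_)
  · rw [abs_mul, abs_of_pos (show 0 < (s / r * zetaGap k)⁻¹ by positivity)]
  · rw [abs_neg, abs_mul, abs_of_pos (show 0 < s / r by positivity)]
  · rw [abs_mul, abs_of_pos (show 0 < r⁻¹ by positivity), mul_assoc]
    gcongr

end Linearization

/-! ### Normality with explicit centring. -/

section Intermediate

variable {Ω : Type*} [MeasurableSpace Ω] {P : Measure Ω} [IsProbabilityMeasure P]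
  {Y : ℕ → Ω → ℝ} {μ : Measure ℝ} [IsProbabilityMeasure μ] {ρ : ℝ} {k : ℕ → ℕ} {t : ℕ → ℝ}

theorem IsLogExpPowerLaw.vanishesInProbability_excessError (hμ : IsLogExpPowerLaw μ ρ)
    (hlaw : ∀ i, HasLaw (Y i) μ P) (hindep : iIndepFun Y P) (hk : Tendsto k atTop atTop)
    (ht : Tendsto t atTop atTop) (hnt : ∀ᶠ n : ℕ in atTop, n * Real.exp (-t n) = k n) :
    VanishesInProbability (fun _ => P) fun n ω => (√((k n : ℝ) - 1))⁻¹ *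
      (∑ i : Fin n, excessError μ (t n) (Y i ω) - n * ∫ y, excessError μ (t n) y ∂μ) := by
  intro ε hε
  have hlim := (((tendsto_div_pred hk).mul (hμ.tendsto_integral_excess_sub_sq.comp ht))).div_const
    (ε ^ 2)
  rw [mul_zero, zero_div] at hlim
  refine squeeze_zero' (Eventually.of_forall fun n => measureReal_nonneg) ?_ hlim
  filter_upwards [ht.eventually hμ.excessError_moments, hnt, hk.eventually_ge_atTop 2]
    with n ⟨hL, _, h2⟩ hn hkn
  have h3 : (2:ℝ) ≤ k n := by exact_mod_cast hkn
  have hm0 : (0:ℝ) < (k n : ℝ) - 1 := by linarith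
  have hr0 : 0 < √((k n : ℝ) - 1) := Real.sqrt_pos.2 hm0
  have h := measureReal_sum_ge_le hlaw hindep (measurable_excessError hμ.continuous_cdf (t n)) hL n
    (c := ε * √((k n : ℝ) - 1)) (by positivity)
  rw [h2, ← mul_assoc, hn, mul_pow, Real.sq_sqrt hm0.le] at h
  refine le_trans (measureReal_mono fun ω hω => ?_) (h.trans_eq ?_)
  · rw [Set.mem_ofPred_eq] at hω ⊢
    rwa [abs_mul, abs_of_pos (inv_pos.2 hr0), inv_mul_eq_div, le_div_iff₀ hr0] at hω
  · simp only [Function.comp]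
    field_simp

/-- Asymptotic normality along intermediate sequences, with explicit centring. -/
theorem IsLogExpPowerLaw.tendstoInDistribution_omegaSample (hμ : IsLogExpPowerLaw μ ρ)
    (hlaw : ∀ i, HasLaw (Y i) μ P) (hindep : iIndepFun Y P) (hk : Tendsto k atTop atTop)
    (ht : Tendsto t atTop atTop) (hnt : ∀ᶠ n : ℕ in atTop, n * Real.exp (-t n) = k n)
    (hkn : ∀ᶠ n in atTop, k n < n) :
    TendstoInDistribution (fun n ω => (omegaSample Y n (k n) ω - omegaCenter μ (k n) (t n)) /
      (logScale μ (t n) * omegaScale (k n))) atTop id (fun _ => P) (gaussianReal 0 1) := by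
  have hF := hμ.continuous_cdf
  have hB := hμ.vanishesInProbability_bahadur hlaw hindep hk ht hnt hkn
  have hZ := boundedInProbability_exceedanceDeviation hF hlaw hindep hk ht hnt
  have hW : BoundedInProbability (fun _ => P) fun n => orderDeviation μ Y n (k n) (t n) := by
    have := hZ.add_vanishes hB
    simpa using this
  have hG := hμ.vanishesInProbability_excessError hlaw hindep hk ht hnt
  have hr : Tendsto (fun n => √((k n : ℝ) / ((k n : ℝ) - 1))) atTop (𝓝 1) := by
    have := (Real.continuous_sqrt.tendsto _).comp (tendsto_div_pred hk)
    rwa [Real.sqrt_one] at this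
  have hc1 : Tendsto (fun n => (√((k n : ℝ) / ((k n : ℝ) - 1)) * zetaGap (k n))⁻¹) atTop (𝓝 0) :=
    tendsto_inv_atTop_zero.comp (hr.pos_mul_atTop one_pos (tendsto_zetaGap hk))
  have hc2 : Tendsto (fun n => (√((k n : ℝ) - 1))⁻¹) atTop (𝓝 0) :=
    tendsto_inv_atTop_zero.comp (Real.tendsto_sqrt_atTop.comp (tendsto_pred_atTop hk))
  refine tendstoInDistribution_gaussian_of_charFun (fun _ => P) _
    (fun n ω => (√((k n : ℝ) - 1))⁻¹ * ∑ i : Fin n, hazardExcess μ (t n) (Y i ω))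
    (fun n => ?_) (fun n => ?_) ?_
    (hμ.tendsto_charFun_sum_hazardExcess hlaw hindep hk ht hnt)
  · exact ((aemeasurable_omegaSample (fun i => (hlaw i).aemeasurable) n (k n)).sub_const _).div_const
      _
  · refine (Finset.aemeasurable_fun_sum _ fun i _ => ?_).const_mul _
    exact (measurable_hazardExcess hF (t n)).comp_aemeasurable (hlaw i).aemeasurable
  have h1 := (vanishesInProbability_const (P := fun _ : ℕ => P) hc1).mul hW
  have h2 := hB.mul (boundedInProbability_const (P := fun _ : ℕ => P) hr)
  have h3 := ((vanishesInProbability_const (P := fun _ : ℕ => P) hc2).mul hW).mul hZ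
  have habs : ∀ X : ∀ n : ℕ, Ω → ℝ, VanishesInProbability (fun _ => P) X →
      VanishesInProbability (fun _ => P) fun n ω => |X n ω| := fun X hX =>
    hX.of_le (Eventually.of_forall fun n ω => by rw [abs_abs])
  refine ((((habs _ h1).add (habs _ hG)).add (habs _ h2)).add (habs _ h3)).of_le ?_
  filter_upwards [ht.eventually hμ.excessError_moments, hnt, hk.eventually_ge_atTop 2, hkn,
    (tendsto_zetaGap hk).eventually_gt_atTop 0, ht.eventually hμ.excess_bounds]
    with n ⟨_, hE, _⟩ hn hk2 hkn' hz ⟨_, ha, _⟩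
  intro ω
  refine (abs_omegaSample_sub_le hk2 hkn'.le ha hz hn hE ω).trans (le_trans ?_ (le_abs_self _))
  have h3 : (2:ℝ) ≤ k n := by exact_mod_cast hk2
  have hm0 : (0:ℝ) < (k n : ℝ) - 1 := by linarith
  have hk0 : (0:ℝ) < k n := by linarith
  refine le_of_eq ?_
  simp only [abs_mul, abs_inv, abs_of_nonneg (Real.sqrt_nonneg _), abs_of_pos hz]
  ring

end Intermediate

/-! ### Recentring and the choice of slow sequences. -/

theorem TendstoInDistribution.congr_eventually {Ω : Type*} [MeasurableSpace Ω] {P : Measure Ω}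
    [IsProbabilityMeasure P] {X X' : ℕ → Ω → ℝ} {ν : Measure ℝ} [IsProbabilityMeasure ν]
    (h : TendstoInDistribution X atTop id (fun _ => P) ν) (hX' : ∀ n, AEMeasurable (X' n) P)
    (heq : ∀ᶠ n in atTop, X n = X' n) : TendstoInDistribution X' atTop id (fun _ => P) ν := by
  refine ⟨hX', h.aemeasurable_limit, h.tendsto.congr' ?_⟩
  filter_upwards [heq] with n hn
  exact Subtype.ext (by simp [hn])

theorem TendstoInDistribution.affine {Ω : Type*} [MeasurableSpace Ω] {P : Measure Ω}
    [IsProbabilityMeasure P] {X : ℕ → Ω → ℝ} {ν : Measure ℝ} [IsProbabilityMeasure ν]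
    (h : TendstoInDistribution X atTop id (fun _ => P) ν) {r s : ℕ → ℝ}
    (hr : Tendsto r atTop (𝓝 1)) (hs : Tendsto s atTop (𝓝 0)) :
    TendstoInDistribution (fun n ω => r n * X n ω + s n) atTop id (fun _ => P) ν := by
  have hc : TendstoInMeasure P (fun n (_ : Ω) => (r n, s n)) atTop fun _ => ((1 : ℝ), (0 : ℝ)) :=
    tendstoInMeasure_of_tendsto_ae (fun n => aestronglyMeasurable_const)
      (Eventually.of_forall fun _ => hr.prodMk_nhds hs)
  have := h.continuous_comp_prodMk_of_tendstoInMeasure_const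
    (g := fun p : ℝ × (ℝ × ℝ) => p.2.1 * p.1 + p.2.2) (by fun_prop) hc
    (fun n => aemeasurable_const)
  simp only [id, one_mul, add_zero] at this
  exact this

/-- Diagonal argument: `κ n` is the largest `m ≤ √n` such that every `f k` with `k ≤ m` is at most
`1/(m + 1)` from `n` on. The cap `√n` forces `κ n / n → 0`. -/
theorem exists_slow_sequence (f : ℕ → ℕ → ℝ) (hf : ∀ k, Tendsto (f k) atTop (𝓝 0)) :
    ∃ κ : ℕ → ℕ, Tendsto κ atTop atTop ∧
      Tendsto (fun n => (κ n : ℝ) / (n : ℝ)) atTop (𝓝 0) ∧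
      ∀ k : ℕ → ℕ, (∀ᶠ n in atTop, k n ≤ κ n) → Tendsto (fun n => f (k n) n) atTop (𝓝 0) := by
  classical
  let p : ℕ → ℕ → Prop := fun m n => ∀ n' ≥ n, ∀ k ≤ m, |f k n'| ≤ 1 / ((m : ℝ) + 1)
  have hp : ∀ m, ∃ N, ∀ n ≥ N, p m n := by
    intro m
    have h1 : ∀ᶠ n in atTop, ∀ k ∈ Finset.range (m + 1), |f k n| ≤ 1 / ((m : ℝ) + 1) := by
      rw [Filter.eventually_all_finset]
      intro k _
      have := (hf k).abs
      rw [abs_zero] at this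
      exact this.eventually_le_const (by positivity)
    obtain ⟨N, hN⟩ := eventually_atTop.1 h1
    exact ⟨N, fun n hn n' hn' k hk =>
      hN n' (le_trans hn hn') k (Finset.mem_range.2 (Nat.lt_succ_of_le hk))⟩
  let κ : ℕ → ℕ := fun n => Nat.findGreatest (fun m => p m n) n.sqrt
  have hκ : Tendsto κ atTop atTop := by
    rw [tendsto_atTop]
    intro m
    obtain ⟨N, hN⟩ := hp m
    filter_upwards [eventually_ge_atTop N, eventually_ge_atTop (m * m)] with n h1 h2
    exact Nat.le_findGreatest (Nat.le_sqrt.2 h2) (hN n h1)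
  refine ⟨κ, hκ, ?_, fun k hk => ?_⟩
  · have hlim : Tendsto (fun n : ℕ => 1 / √(n : ℝ)) atTop (𝓝 0) :=
      tendsto_const_nhds.div_atTop (Real.tendsto_sqrt_atTop.comp tendsto_natCast_atTop_atTop)
    refine squeeze_zero' (Eventually.of_forall fun n => by positivity) ?_ hlim
    filter_upwards [eventually_gt_atTop 0] with n hn
    have hn' : (0:ℝ) < n := by exact_mod_cast hn
    have h1 : (κ n : ℝ) ≤ √(n : ℝ) := by
      have : (κ n : ℝ) ≤ (n.sqrt : ℝ) := by exact_mod_cast Nat.findGreatest_le _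
      exact this.trans Real.nat_sqrt_le_real_sqrt
    have hs := Real.sqrt_pos.2 hn'
    rw [div_le_div_iff₀ hn' hs, one_mul]
    calc (κ n : ℝ) * √(n : ℝ) ≤ √(n : ℝ) * √(n : ℝ) := by gcongr
      _ = n := Real.mul_self_sqrt hn'.le
  · have hlim : Tendsto (fun n => 1 / ((κ n : ℝ) + 1)) atTop (𝓝 0) :=
      tendsto_one_div_add_atTop_nhds_zero_nat.comp hκ
    refine squeeze_zero_norm' ?_ hlim
    -- The value `0` is the default of `Nat.findGreatest` and guarantees nothing, so `κ n > 0` is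
    -- needed.
    filter_upwards [hk, hκ.eventually_gt_atTop 0] with n h1 h2
    have h3 : p (κ n) n := Nat.findGreatest_of_ne_zero (P := fun m => p m n) rfl h2.ne'
    exact h3 n le_rfl _ h1

/-- With `m = k - 1`, Euler's constant lies between `H_m - log (m + 1)` and `H_m - log m`. A rate is
needed because the difference is later multiplied by a factor of order `√k`. -/
theorem abs_zetaGap_sub_log_le {k : ℕ} (hk : 2 ≤ k) :
    |zetaGap k - Real.log k| ≤ 1 / ((k : ℝ) - 1) := by
  obtain ⟨m, rfl⟩ : ∃ m, k = m + 1 := ⟨k - 1, by omega⟩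
  have hm : 0 < m := by omega
  have hm' : (0:ℝ) < m := by exact_mod_cast hm
  have h1 := Real.eulerMascheroniSeq_lt_eulerMascheroniConstant m
  have h2 := Real.eulerMascheroniConstant_lt_eulerMascheroniSeq' m
  rw [Real.eulerMascheroniSeq] at h1
  rw [Real.eulerMascheroniSeq', if_neg hm.ne'] at h2
  have h3 : Real.log (m + 1) - Real.log m ≤ 1 / m := by
    rw [← Real.log_div (by positivity) hm'.ne']
    refine (Real.log_le_sub_one_of_pos (by positivity)).trans_eq ?_
    field_simp
    ring
  simp only [zetaGap, Nat.add_sub_cancel]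
  push_cast
  rw [add_sub_cancel_right, abs_le]
  constructor <;> linarith [show 0 ≤ 1 / (m:ℝ) by positivity]

/-- The limiting bias of `omegaStat` centred at the extreme quantile. -/
noncomputable def omegaBias (k : ℕ) : ℝ :=
  (-Real.log k + zetaGap k / ((k : ℝ) - 1) * k) / omegaScale k

theorem tendsto_omegaBias {k : ℕ → ℕ} (hk : Tendsto k atTop atTop) :
    Tendsto (fun n => omegaBias (k n)) atTop (𝓝 0) := by
  have hs : Tendsto (fun n => √((k n : ℝ) - 1)) atTop atTop :=
    Real.tendsto_sqrt_atTop.comp (tendsto_pred_atTop hk)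
  have hlim : Tendsto (fun n => 2 / √((k n : ℝ) - 1)) atTop (𝓝 0) :=
    tendsto_const_nhds.div_atTop hs
  refine squeeze_zero_norm' ?_ hlim
  filter_upwards [hk.eventually_ge_atTop 2, (tendsto_zetaGap hk).eventually_ge_atTop 1]
    with n hk2 hz
  have h2 : (2:ℝ) ≤ k n := by exact_mod_cast hk2
  have hm0 : (0:ℝ) < (k n : ℝ) - 1 := by linarith
  obtain ⟨r, hr0, hrk⟩ : ∃ r : ℝ, 0 < r ∧ √((k n : ℝ) - 1) = r := ⟨_, Real.sqrt_pos.2 hm0, rfl⟩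
  have hr2 : (k n : ℝ) - 1 = r ^ 2 := by rw [← hrk, Real.sq_sqrt hm0.le]
  have hk' : (k n : ℝ) = r ^ 2 + 1 := by linarith
  have h := abs_zetaGap_sub_log_le hk2
  have hz0 : 0 < zetaGap (k n) := by linarith
  rw [Real.norm_eq_abs, omegaBias, omegaScale, hrk]
  rw [hr2] at h ⊢
  -- The term `1 / r` comes from the mismatch of `k` exceedances against the divisor `k - 1`.
  have e1 : (-Real.log (k n) + zetaGap (k n) / r ^ 2 * k n) / (zetaGap (k n) / r) =
      1 / r + r * (zetaGap (k n) - Real.log (k n)) / zetaGap (k n) := by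
    rw [hk']
    field_simp
    ring
  rw [e1]
  calc |1 / r + r * (zetaGap (k n) - Real.log (k n)) / zetaGap (k n)|
      ≤ 1 / r + r * (1 / r ^ 2) / 1 := by
        refine (abs_add_le _ _).trans ?_
        rw [abs_of_pos (show 0 < 1 / r by positivity), abs_div, abs_mul, abs_of_pos hr0,
          abs_of_pos hz0]
        gcongr
    _ = 2 / r := by field_simp; ring

/-! ### The intermediate and the slow regimes. -/

section Intermediate

variable {Ω : Type*} [MeasurableSpace Ω] {P : Measure Ω} [IsProbabilityMeasure P]
  {Y : ℕ → Ω → ℝ} {μ : Measure ℝ} {ρ : ℝ} {k : ℕ → ℕ}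

theorem eventually_lt_of_tendsto_div (hkn : Tendsto (fun n => (k n : ℝ) / (n : ℝ)) atTop (𝓝 0)) :
    ∀ᶠ n in atTop, k n < n := by
  filter_upwards [hkn.eventually (gt_mem_nhds zero_lt_one), eventually_gt_atTop 0] with n h hn
  rw [div_lt_one (by exact_mod_cast hn)] at h
  exact_mod_cast h

theorem tendsto_log_div (hk : Tendsto k atTop atTop)
    (hkn : Tendsto (fun n => (k n : ℝ) / (n : ℝ)) atTop (𝓝 0)) :
    Tendsto (fun n : ℕ => Real.log ((n : ℝ) / k n)) atTop atTop := by
  refine Real.tendsto_log_atTop.comp ?_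
  have h : Tendsto (fun n => (k n : ℝ) / (n : ℝ)) atTop (𝓝[>] 0) := by
    refine tendsto_nhdsWithin_iff.2 ⟨hkn, ?_⟩
    filter_upwards [hk.eventually_gt_atTop 0, eventually_gt_atTop 0] with n h1 h2
    have h1' : (0:ℝ) < k n := by exact_mod_cast h1
    have h2' : (0:ℝ) < n := by exact_mod_cast h2
    exact div_pos h1' h2'
  refine h.inv_tendsto_nhdsGT_zero.congr fun n => ?_
  simp

theorem eventually_mul_exp_neg_log (hk : Tendsto k atTop atTop) :
    ∀ᶠ n : ℕ in atTop, n * Real.exp (-Real.log ((n : ℝ) / k n)) = k n := by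
  filter_upwards [hk.eventually_gt_atTop 0, eventually_gt_atTop 0] with n h1 h2
  have h1' : (0:ℝ) < k n := by exact_mod_cast h1
  have h2' : (0:ℝ) < n := by exact_mod_cast h2
  rw [Real.exp_neg, Real.exp_log (by positivity)]
  field_simp

theorem gumbelScale_eq_logScale {x : ℝ} (hx : 0 < x) :
    gumbelScale μ x = logScale μ (Real.log x) := by
  rw [logScale, ← gumbelScale_exp, Real.exp_log hx]

/-- For fixed `k`, the quantile moves by `-log k` scales, the scales agree asymptotically, and the
mean normalized excess tends to `1`. -/
theorem IsLogExpPowerLaw.tendsto_omegaCenter (hμ : IsLogExpPowerLaw μ ρ) (k : ℕ) :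
    Tendsto (fun t => (omegaCenter μ k (t - Real.log k) - logQuantile μ t) /
      (logScale μ t * omegaScale k)) atTop (𝓝 (omegaBias k)) := by
  have h1 := hμ.tendsto_increment (-Real.log k)
  have h2 := hμ.tendsto_scale_ratio (-Real.log k)
  have h3 := hμ.tendsto_integral_excess.comp
    (tendsto_atTop_add_const_right atTop (-Real.log k) tendsto_id)
  have h4 := (h1.add ((h2.mul (h3.const_mul (k : ℝ))).const_mul
    (zetaGap k / ((k : ℝ) - 1)))).div_const (omegaScale k)
  rw [one_mul, mul_one] at h4
  refine h4.congr fun t => ?_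
  simp only [Function.comp, id, omegaCenter, sub_eq_add_neg]
  rw [← div_div]
  congr 1
  ring

variable [IsProbabilityMeasure μ]

theorem IsLogExpPowerLaw.omegaSample_intermediate (hμ : IsLogExpPowerLaw μ ρ)
    (hlaw : ∀ i, HasLaw (Y i) μ P) (hindep : iIndepFun Y P) (hk : Tendsto k atTop atTop)
    (hkn : Tendsto (fun n => (k n : ℝ) / (n : ℝ)) atTop (𝓝 0)) :
    ∃ c : ℕ → ℝ, TendstoInDistribution
      (fun n ω => (omegaSample Y n (k n) ω - c n) /
        (gumbelScale μ ((n : ℝ) / (k n : ℝ)) * omegaScale (k n))) atTop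
      id (fun _ => P) (gaussianReal 0 1) := by
  refine ⟨fun n => omegaCenter μ (k n) (Real.log ((n : ℝ) / k n)), ?_⟩
  refine TendstoInDistribution.congr_eventually (hμ.tendstoInDistribution_omegaSample hlaw hindep hk
    (tendsto_log_div hk hkn) (eventually_mul_exp_neg_log hk) (eventually_lt_of_tendsto_div hkn))
    (fun n => ?_) ?_
  · exact ((aemeasurable_omegaSample (fun i => (hlaw i).aemeasurable) n (k n)).sub_const
      _).div_const _
  · filter_upwards [hk.eventually_gt_atTop 0, eventually_gt_atTop 0] with n h1 h2
    have h1' : (0:ℝ) < k n := by exact_mod_cast h1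
    have h2' : (0:ℝ) < n := by exact_mod_cast h2
    rw [gumbelScale_eq_logScale (div_pos h2' h1')]

theorem IsLogExpPowerLaw.omegaSample_slow (hμ : IsLogExpPowerLaw μ ρ)
    (hlaw : ∀ i, HasLaw (Y i) μ P) (hindep : iIndepFun Y P) :
    ∃ κ : ℕ → ℕ, Tendsto κ atTop atTop ∧
      Tendsto (fun n => (κ n : ℝ) / (n : ℝ)) atTop (𝓝 0) ∧
      ∀ k : ℕ → ℕ, Tendsto k atTop atTop → (∀ᶠ n in atTop, k n ≤ κ n) →
        TendstoInDistribution
          (fun n ω => (omegaSample Y n (k n) ω - quantile μ (1 - 1 / (n : ℝ))) /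
            (gumbelScale μ (n : ℝ) * omegaScale (k n))) atTop
          id (fun _ => P) (gaussianReal 0 1) := by
  have hlog : Tendsto (fun n : ℕ => Real.log n) atTop atTop :=
    Real.tendsto_log_atTop.comp tendsto_natCast_atTop_atTop
  set s : ℕ → ℕ → ℝ := fun k n => (omegaCenter μ k (Real.log n - Real.log k) -
    logQuantile μ (Real.log n)) / (logScale μ (Real.log n) * omegaScale k)
  set r : ℕ → ℕ → ℝ := fun k n =>
    logScale μ (Real.log n - Real.log k) / logScale μ (Real.log n)
  have hs : ∀ k, Tendsto (s k) atTop (𝓝 (omegaBias k)) := fun k =>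
    (hμ.tendsto_omegaCenter k).comp hlog
  have hr : ∀ k, Tendsto (r k) atTop (𝓝 1) := fun k =>
    (hμ.tendsto_scale_ratio (-Real.log k)).comp hlog
  obtain ⟨κ, hκ, hκn, hslow⟩ := exists_slow_sequence
    (fun k n => |s k n - omegaBias k| + |r k n - 1|) fun k => by
      have h1 := ((hs k).sub_const (omegaBias k)).abs
      have h2 := ((hr k).sub_const 1).abs
      have := h1.add h2
      simpa using this
  refine ⟨κ, hκ, hκn, fun k hk hkκ => ?_⟩
  have hkn : Tendsto (fun n => (k n : ℝ) / (n : ℝ)) atTop (𝓝 0) := by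
    refine squeeze_zero' (Eventually.of_forall fun n => by positivity) ?_ hκn
    filter_upwards [hkκ] with n hn
    gcongr
  have h0 := hslow k hkκ
  have hs' : Tendsto (fun n => s (k n) n) atTop (𝓝 0) := by
    have h1 : Tendsto (fun n => s (k n) n - omegaBias (k n)) atTop (𝓝 0) :=
      squeeze_zero_norm (fun n => le_add_of_nonneg_right (abs_nonneg _)) h0
    simpa using h1.add (tendsto_omegaBias hk)
  have hr' : Tendsto (fun n => r (k n) n) atTop (𝓝 1) := by
    have h1 : Tendsto (fun n => r (k n) n - 1) atTop (𝓝 0) :=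
      squeeze_zero_norm (fun n => le_add_of_nonneg_left (abs_nonneg _)) h0
    simpa using h1.add_const 1
  refine TendstoInDistribution.congr_eventually (TendstoInDistribution.affine
    (hμ.tendstoInDistribution_omegaSample hlaw hindep hk
    (tendsto_log_div hk hkn) (eventually_mul_exp_neg_log hk) (eventually_lt_of_tendsto_div hkn))
    hr' hs') (fun n => ?_) ?_
  · exact ((aemeasurable_omegaSample (fun i => (hlaw i).aemeasurable) n (k n)).sub_const
      _).div_const _
  · filter_upwards [hk.eventually_gt_atTop 0, eventually_gt_atTop 0,
      (tendsto_log_div hk hkn).eventually hμ.excess_bounds] with n h1 h2 ⟨_, ha, _⟩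
    have h1' : (0:ℝ) < k n := by exact_mod_cast h1
    have h2' : (0:ℝ) < n := by exact_mod_cast h2
    have hq : quantile μ (1 - 1 / (n : ℝ)) = logQuantile μ (Real.log n) := by
      rw [logQuantile, tailQuantile, Real.exp_log h2']
    rw [gumbelScale_eq_logScale h2', hq]
    rw [Real.log_div h2'.ne' h1'.ne'] at *
    ext ω
    simp only [s, r]
    set a := logScale μ (Real.log n - Real.log (k n))
    have e : ∀ x y z b σ : ℝ, a / b * ((x - y) / (a * σ)) + (y - z) / (b * σ) =
        (x - z) / (b * σ) := by
      intro x y z b σ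
      rw [show a / b * ((x - y) / (a * σ)) = (x - y) / (b * σ) by
        rw [div_mul_div_comm, mul_comm b, mul_assoc, mul_div_mul_left _ _ ha.ne', mul_comm σ b]]
      rw [← add_div]
      ring
    exact e _ _ _ _ _

end Intermediate

/-! ### Spacings under the limit law. -/

section Spacings

theorem lintegral_pi_snoc {m : ℕ} {f : (Fin (m + 1) → ℝ) → ENNReal} (hf : Measurable f) :
    ∫⁻ x, f x = ∫⁻ z : ℝ, ∫⁻ y : Fin m → ℝ, f (Fin.snoc (α := fun _ => ℝ) y z) := by
  have h := (volume_preserving_piFinSuccAbove (fun _ : Fin (m + 1) => ℝ) (Fin.last m)).symm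
  have hsn : ∀ p : ℝ × (Fin m → ℝ),
      (MeasurableEquiv.piFinSuccAbove (fun _ : Fin (m + 1) => ℝ) (Fin.last m)).symm p =
        Fin.snoc (α := fun _ => ℝ) p.2 p.1 := fun p => by
    rw [← Fin.insertNth_last']
    rfl
  rw [← h.lintegral_comp hf, Measure.volume_eq_prod, lintegral_prod _ (by
    exact (hf.comp (MeasurableEquiv.measurable _)).aemeasurable)]
  simp only [hsn]

/-- Strictly decreasing vectors with entries above `b`. -/
def decreasingAbove (m : ℕ) (b : ℝ) : Set (Fin m → ℝ) := {x | StrictAnti x ∧ ∀ i, b < x i}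

theorem measurableSet_strictAnti (m : ℕ) : MeasurableSet {x : Fin m → ℝ | StrictAnti x} := by
  have : {x : Fin m → ℝ | StrictAnti x} = ⋂ i, ⋂ j, ⋂ (_ : i < j), {x | x j < x i} := by
    ext x
    simp only [Set.mem_ofPred_eq, Set.mem_iInter, StrictAnti]
  rw [this]
  exact MeasurableSet.iInter fun i => MeasurableSet.iInter fun j => MeasurableSet.iInter fun _ =>
    measurableSet_lt (measurable_pi_apply j) (measurable_pi_apply i)

theorem measurableSet_decreasingAbove (m : ℕ) (b : ℝ) : MeasurableSet (decreasingAbove m b) := by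
  refine (measurableSet_strictAnti m).inter ?_
  have : {x : Fin m → ℝ | ∀ i, b < x i} = ⋂ i, {x | b < x i} := by
    ext x; simp
  change MeasurableSet {x : Fin m → ℝ | ∀ i, b < x i}
  rw [this]
  exact MeasurableSet.iInter fun i => measurableSet_lt measurable_const (measurable_pi_apply i)

theorem strictAnti_snoc_iff {m : ℕ} (y : Fin m → ℝ) (z : ℝ) :
    StrictAnti (Fin.snoc (α := fun _ => ℝ) y z : Fin (m + 1) → ℝ) ↔ y ∈ decreasingAbove m z := by
  constructor
  · intro h
    refine ⟨fun i j hij => ?_, fun i => ?_⟩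
    · have := h (Fin.castSucc_lt_castSucc_iff.2 hij)
      simpa using this
    · have := h (Fin.castSucc_lt_last i)
      simpa using this
  · rintro ⟨h1, h2⟩ i j hij
    induction j using Fin.lastCases with
    | last =>
      induction i using Fin.lastCases with
      | last => exact absurd hij (lt_irrefl _)
      | cast i => simpa using h2 i
    | cast j =>
      induction i using Fin.lastCases with
      | last => exact absurd hij (not_lt.2 (Fin.le_last _))
      | cast i => simpa using h1 (Fin.castSucc_lt_castSucc_iff.1 hij)

theorem snoc_mem_decreasingAbove_iff {m : ℕ} (y : Fin m → ℝ) (z b : ℝ) :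
    (Fin.snoc (α := fun _ => ℝ) y z : Fin (m + 1) → ℝ) ∈ decreasingAbove (m + 1) b ↔
      b < z ∧ y ∈ decreasingAbove m z := by
  constructor
  · rintro ⟨h1, h2⟩
    exact ⟨by simpa using h2 (Fin.last m), (strictAnti_snoc_iff y z).1 h1⟩
  · rintro ⟨h1, h2⟩
    refine ⟨(strictAnti_snoc_iff y z).2 h2, fun i => ?_⟩
    induction i using Fin.lastCases with
    | last => simpa using h1
    | cast i => simpa using h1.trans (h2.2 i)

/-- The law of a sum of `m` independent standard exponential variables. -/
noncomputable def expSumLaw : ℕ → Measure ℝ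
  | 0 => Measure.dirac 0
  | m + 1 => expSumLaw m ∗ expMeasure 1

instance isProbabilityMeasure_expSumLaw (m : ℕ) : IsProbabilityMeasure (expSumLaw m) := by
  induction m with
  | zero => rw [expSumLaw]; infer_instance
  | succ m ih => rw [expSumLaw]; infer_instance

theorem charFun_expSumLaw (m : ℕ) (θ : ℝ) :
    charFun (expSumLaw m) θ = charFun (expMeasure 1) θ ^ m := by
  induction m with
  | zero => simp [expSumLaw]
  | succ m ih => rw [expSumLaw, charFun_conv, ih, pow_succ]

theorem lintegral_Ioi_affine {c : ℝ} (hc : 0 < c) (b : ℝ) (g : ℝ → ENNReal) :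
    ∫⁻ v in Set.Ioi 0, g v = ENNReal.ofReal c * ∫⁻ z in Set.Ioi b, g (c * (z - b)) := by
  have himg : (fun z => c * (z - b)) '' Set.Ioi b = Set.Ioi 0 := by
    ext v
    simp only [Set.mem_image, Set.mem_Ioi]
    constructor
    · rintro ⟨z, hz, rfl⟩
      exact mul_pos hc (sub_pos.2 hz)
    · intro hv
      exact ⟨b + v / c, by have := div_pos hv hc; linarith, by field_simp; ring⟩
  have hd : ∀ z ∈ Set.Ioi b, HasDerivWithinAt (fun z => c * (z - b)) c (Set.Ioi b) z :=
    fun z _ => by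
      simpa using (((hasDerivAt_id z).sub_const b).const_mul c).hasDerivWithinAt
  have hinj : Set.InjOn (fun z => c * (z - b)) (Set.Ioi b) := by
    intro x _ y _ hxy
    have := mul_left_cancel₀ hc.ne' hxy
    linarith
  rw [← himg, lintegral_image_eq_lintegral_abs_deriv_mul measurableSet_Ioi hd hinj, abs_of_pos hc,
    lintegral_const_mul' _ _ ENNReal.ofReal_ne_top]

/-- Rényi's argument: the smallest coordinate `z` is integrated last. The sum of excesses over `b`
splits into that over `z` plus `(m + 1) (z - b)`; the latter contributes a new standard exponential,
and the change of variable produces the factor `1 / (m + 1)` of the factorial. -/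
theorem lintegral_decreasingAbove (m : ℕ) (b : ℝ) {f : ℝ → ENNReal} (hf : Measurable f) :
    ∫⁻ x, (decreasingAbove m b).indicator (fun x => ENNReal.ofReal (Real.exp (-∑ i, (x i - b))) *
      f (∑ i, (x i - b))) x = (m.factorial : ENNReal)⁻¹ * ∫⁻ s, f s ∂expSumLaw m := by
  induction m generalizing b f with
  | zero =>
    have : (decreasingAbove 0 b) = Set.univ := by
      ext x
      simp [decreasingAbove, Subsingleton.strictAnti]
    simp [this, expSumLaw, lintegral_dirac' _ hf, volume_pi]
  | succ m ih =>
    have hmeas : ∀ (m : ℕ) (b : ℝ) {f : ℝ → ENNReal} (_ : Measurable f),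
        Measurable ((decreasingAbove m b).indicator (fun x =>
          ENNReal.ofReal (Real.exp (-∑ i, (x i - b))) * f (∑ i, (x i - b)))) := by
      intro m b f hf
      refine Measurable.indicator (Measurable.mul (by fun_prop) (hf.comp (by fun_prop)))
        (measurableSet_decreasingAbove m b)
    have hm : (0:ℝ) < m + 1 := by positivity
    rw [lintegral_pi_snoc (hmeas _ _ hf)]
    have hstep : ∀ z : ℝ, ∫⁻ y : Fin m → ℝ, (decreasingAbove (m + 1) b).indicator (fun x =>
        ENNReal.ofReal (Real.exp (-∑ i, (x i - b))) * f (∑ i, (x i - b)))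
          (Fin.snoc (α := fun _ => ℝ) y z) =
        (Set.Ioi b).indicator (fun z => (m.factorial : ENNReal)⁻¹ *
          (ENNReal.ofReal (Real.exp (-((m + 1) * (z - b)))) *
            ∫⁻ s, f (s + (m + 1) * (z - b)) ∂expSumLaw m)) z := by
      intro z
      by_cases hz : b < z
      · rw [Set.indicator_of_mem (Set.mem_Ioi.2 hz), mul_left_comm]
        rw [← ih z (f := fun s => f (s + (m + 1) * (z - b))) (hf.comp (by fun_prop)),
          ← lintegral_const_mul _ (hmeas m z (f := fun s => f (s + (m + 1) * (z - b)))
            (hf.comp (by fun_prop)))]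
        refine lintegral_congr fun y => ?_
        by_cases hy : y ∈ decreasingAbove m z
        · rw [Set.indicator_of_mem ((snoc_mem_decreasingAbove_iff y z b).2 ⟨hz, hy⟩),
            Set.indicator_of_mem hy]
          have hsum : ∑ i, ((Fin.snoc (α := fun _ => ℝ) y z : Fin (m + 1) → ℝ) i - b) =
              ∑ i, (y i - z) + (m + 1) * (z - b) := by
            rw [Fin.sum_univ_castSucc]
            simp only [Fin.snoc_castSucc, Fin.snoc_last, Finset.sum_sub_distrib, Finset.sum_const,
              Finset.card_univ, Fintype.card_fin, nsmul_eq_mul]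
            ring
          rw [hsum, ← mul_assoc, ← ENNReal.ofReal_mul (Real.exp_pos _).le, ← Real.exp_add]
          congr 3
          ring
        · rw [Set.indicator_of_notMem
            (fun h => hy ((snoc_mem_decreasingAbove_iff y z b).1 h).2),
            Set.indicator_of_notMem hy, mul_zero]
      · rw [Set.indicator_of_notMem (by simpa using hz)]
        rw [lintegral_congr (g := fun _ => 0) fun y => Set.indicator_of_notMem
          (fun h => hz ((snoc_mem_decreasingAbove_iff y z b).1 h).1) _]
        simp
    rw [lintegral_congr hstep, lintegral_indicator measurableSet_Ioi,
      lintegral_const_mul' _ _ (by simp [Nat.factorial_ne_zero])]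
    have haff := lintegral_Ioi_affine hm b
      (fun v => ENNReal.ofReal (Real.exp (-v)) * ∫⁻ s, f (s + v) ∂expSumLaw m)
    have hconv : ∫⁻ s, f s ∂expSumLaw (m + 1) =
        ∫⁻ v in Set.Ioi 0, ENNReal.ofReal (Real.exp (-v)) * ∫⁻ s, f (s + v) ∂expSumLaw m := by
      have hmm : Measurable fun v => ∫⁻ s, f (s + v) ∂expSumLaw m := by
        exact Measurable.lintegral_prod_left' (f := fun p : ℝ × ℝ => f (p.1 + p.2))
          (hf.comp (by fun_prop))
      rw [← lintegral_expMeasure_one _ hmm, expSumLaw, Measure.lintegral_conv hf,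
        lintegral_lintegral_swap (f := fun s v => f (s + v))
          (hf.comp measurable_add).aemeasurable]
    rw [hconv, haff, ← mul_assoc]
    congr 1
    rw [Nat.factorial_succ, Nat.cast_mul,
      ENNReal.mul_inv (Or.inr (by simp)) (Or.inl (by simp)),
      show ((m + 1 : ℕ) : ENNReal) = ENNReal.ofReal ((m : ℝ) + 1) by
        rw [← ENNReal.ofReal_natCast]; push_cast; rfl, mul_right_comm,
      ENNReal.inv_mul_cancel (by simpa using hm) ENNReal.ofReal_ne_top, one_mul]

/-- The sum of the excesses over the last coordinate. -/
noncomputable def excessSum (m : ℕ) (g : Fin (m + 1) → ℝ) : ℝ :=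
  ∑ i : Fin m, (g i.castSucc - g (Fin.last m))

theorem measurable_excessSum (m : ℕ) : Measurable (excessSum m) := by
  unfold excessSum
  fun_prop

theorem lintegral_exp_neg_substitution {g : ℝ → ENNReal} :
    ∫⁻ w in Set.Ioi 0, g w = ∫⁻ z : ℝ, ENNReal.ofReal (Real.exp (-z)) * g (Real.exp (-z)) := by
  have himg : (fun z : ℝ => Real.exp (-z)) '' Set.univ = Set.Ioi 0 := by
    ext w
    simp only [Set.image_univ, Set.mem_range, Set.mem_Ioi]
    exact ⟨fun ⟨z, hz⟩ => hz ▸ Real.exp_pos _, fun hw => ⟨-Real.log w, by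
      rw [neg_neg, Real.exp_log hw]⟩⟩
  have hd : ∀ z ∈ (Set.univ : Set ℝ),
      HasDerivWithinAt (fun z : ℝ => Real.exp (-z)) (-Real.exp (-z)) Set.univ z := fun z _ => by
    have := ((hasDerivAt_neg z).exp).hasDerivWithinAt (s := Set.univ)
    rwa [mul_neg_one] at this
  have hinj : Set.InjOn (fun z : ℝ => Real.exp (-z)) Set.univ := by
    intro x _ y _ hxy
    have := Real.exp_injective hxy
    linarith
  rw [← himg, lintegral_image_eq_lintegral_abs_deriv_mul MeasurableSet.univ hd hinj,
    setLIntegral_univ]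
  simp only [abs_neg, Real.abs_exp]

/-- Given the last coordinate `z`, the density depends on the others through their excesses over `z`
only. In `w = e^{-z}`, one factor `e^{-z}` is the Jacobian and the other `m` give `w^m`; the excess
sum is thus independent of a Gamma variable. -/
theorem lintegral_gumbelTopLaw (m : ℕ) {f p : ℝ → ENNReal} (hf : Measurable f)
    (hp : Measurable p) :
    ∫⁻ g, f (excessSum m g) * p (Real.exp (-g (Fin.last m))) ∂gumbelTopLaw (m + 1) =
      (m.factorial : ENNReal)⁻¹ * (∫⁻ s, f s ∂expSumLaw m) *
        ∫⁻ w, ENNReal.ofReal (w ^ m) * p w ∂expMeasure 1 := by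
  set D : (Fin (m + 1) → ℝ) → ENNReal := Set.indicator {g | StrictAnti g} fun g =>
    ENNReal.ofReal (Real.exp (-Real.exp (-g (Fin.last m)) - ∑ i, g i)) with hD
  have hDm : Measurable D := Measurable.indicator (by fun_prop) (measurableSet_strictAnti _)
  have hFm : Measurable fun g : Fin (m + 1) → ℝ =>
      f (excessSum m g) * p (Real.exp (-g (Fin.last m))) :=
    (hf.comp (measurable_excessSum m)).mul (hp.comp (by fun_prop))
  have hstep : ∀ z : ℝ, ∫⁻ y : Fin m → ℝ, (D * fun g : Fin (m + 1) → ℝ =>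
      f (excessSum m g) * p (Real.exp (-g (Fin.last m)))) (Fin.snoc (α := fun _ => ℝ) y z) =
      ((m.factorial : ENNReal)⁻¹ * (∫⁻ s, f s ∂expSumLaw m)) *
        (ENNReal.ofReal (Real.exp (-z)) * (ENNReal.ofReal (Real.exp (-Real.exp (-z))) *
        (ENNReal.ofReal (Real.exp (-z) ^ m) * p (Real.exp (-z))))) := by
    intro z
    rw [← lintegral_decreasingAbove m z hf, ← lintegral_mul_const]
    · refine lintegral_congr fun y => ?_
      by_cases hy : y ∈ decreasingAbove m z
      · have hy' := (strictAnti_snoc_iff y z).2 hy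
        have hsum : ∑ i, (Fin.snoc (α := fun _ => ℝ) y z : Fin (m + 1) → ℝ) i =
            ∑ i, (y i - z) + (m + 1) * z := by
          rw [Fin.sum_univ_castSucc]
          simp only [Fin.snoc_castSucc, Fin.snoc_last, Finset.sum_sub_distrib, Finset.sum_const,
            Finset.card_univ, Fintype.card_fin, nsmul_eq_mul]
          ring
        rw [Pi.mul_apply, hD, Set.indicator_of_mem (show _ ∈ {g | StrictAnti g} from hy'),
          Set.indicator_of_mem hy, hsum]
        simp only [excessSum, Fin.snoc_castSucc, Fin.snoc_last]
        have e : ENNReal.ofReal (Real.exp (-Real.exp (-z) - (∑ i, (y i - z) + (m + 1) * z))) =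
            ENNReal.ofReal (Real.exp (-∑ i, (y i - z))) * (ENNReal.ofReal (Real.exp (-z)) *
              (ENNReal.ofReal (Real.exp (-Real.exp (-z))) *
                ENNReal.ofReal (Real.exp (-z) ^ m))) := by
          rw [← ENNReal.ofReal_mul (Real.exp_pos _).le, ← ENNReal.ofReal_mul (Real.exp_pos _).le,
            ← ENNReal.ofReal_mul (Real.exp_pos _).le, ← Real.exp_nat_mul, ← Real.exp_add,
            ← Real.exp_add, ← Real.exp_add]
          congr 2
          ring
        rw [e]
        ring
      · rw [Pi.mul_apply, hD, Set.indicator_of_notMem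
          (fun h => hy ((strictAnti_snoc_iff y z).1 h)), Set.indicator_of_notMem hy]
        simp
    · exact Measurable.indicator (Measurable.mul (by fun_prop) (hf.comp (by fun_prop)))
        (measurableSet_decreasingAbove m z)
  rw [gumbelTopLaw, lintegral_withDensity_eq_lintegral_mul _ hDm hFm,
    lintegral_pi_snoc (hDm.mul hFm), lintegral_congr hstep, lintegral_const_mul]
  · rw [lintegral_expMeasure_one (fun w => ENNReal.ofReal (w ^ m) * p w)
      (Measurable.mul (by fun_prop) hp), lintegral_exp_neg_substitution]
  · have : Measurable fun z : ℝ => p (Real.exp (-z)) := hp.comp (by fun_prop)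
    fun_prop

theorem lintegral_ofReal_expMeasure {q : ℝ → ℝ} (hq : ∀ x, 0 < x → 0 ≤ q x)
    (hi : Integrable q (expMeasure 1)) :
    ∫⁻ x, ENNReal.ofReal (q x) ∂expMeasure 1 = ENNReal.ofReal (∫ x, q x ∂expMeasure 1) := by
  rw [ofReal_integral_eq_lintegral_ofReal hi]
  filter_upwards [ae_expMeasure_pos] with x hx using hq x hx

theorem lintegral_pow_expMeasure (m : ℕ) :
    ∫⁻ w, ENNReal.ofReal (w ^ m) ∂expMeasure 1 = m.factorial := by
  rw [lintegral_ofReal_expMeasure (fun x hx => by positivity) (integrable_pow_expMeasure m),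
    integral_pow_expMeasure, ENNReal.ofReal_natCast]

theorem map_excessSum_gumbelTopLaw (m : ℕ) :
    (gumbelTopLaw (m + 1)).map (excessSum m) = expSumLaw m := by
  ext s hs
  have h := lintegral_gumbelTopLaw m (f := s.indicator 1) (p := 1)
    (measurable_one.indicator hs) measurable_one
  simp only [Pi.one_apply, mul_one] at h
  rw [lintegral_pow_expMeasure, lintegral_indicator_one hs, mul_right_comm,
    ENNReal.inv_mul_cancel (by simp [Nat.factorial_ne_zero]) (by simp), one_mul] at h
  rw [Measure.map_apply (measurable_excessSum m) hs, ← h,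
    ← lintegral_indicator_one (measurable_excessSum m hs)]
  rfl

/-- The variance of the Gamma law of shape `m + 1`, before division by `m!`. -/
theorem integral_gamma_sq (m : ℕ) : Integrable (fun w : ℝ => w ^ m * (w - (m + 1)) ^ 2) (expMeasure 1) ∧
    ∫ w : ℝ, w ^ m * (w - (m + 1)) ^ 2 ∂expMeasure 1 = (m.factorial : ℝ) * (m + 1) := by
  have e : (fun w : ℝ => w ^ m * (w - (m + 1)) ^ 2) = fun w : ℝ =>
      w ^ (m + 2) - 2 * (m + 1) * w ^ (m + 1) + (m + 1) ^ 2 * w ^ m := by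
    ext w; ring
  have h0 := integrable_pow_expMeasure m
  have h1 := integrable_pow_expMeasure (m + 1)
  have h2 := integrable_pow_expMeasure (m + 2)
  have h3 : Integrable (fun w : ℝ => w ^ (m + 2) - 2 * (m + 1) * w ^ (m + 1)) (expMeasure 1) :=
    h2.sub (h1.const_mul _)
  rw [e]
  refine ⟨h3.add (h0.const_mul _), ?_⟩
  rw [integral_add h3 (h0.const_mul _), integral_sub h2 (h1.const_mul _), integral_const_mul,
    integral_const_mul, integral_pow_expMeasure, integral_pow_expMeasure, integral_pow_expMeasure,
    Nat.factorial_succ (m + 1), Nat.factorial_succ m]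
  push_cast
  ring

theorem gumbelTopLaw_exp_neg_last_le (m : ℕ) {c : ℝ} (hc : 0 < c) :
    gumbelTopLaw (m + 1) {g | c ≤ |Real.exp (-g (Fin.last m)) - (m + 1)|} ≤
      ENNReal.ofReal ((m + 1) / c ^ 2) := by
  have h := lintegral_gumbelTopLaw m (f := 1) (p := fun w => ENNReal.ofReal ((w - (m + 1)) ^ 2))
    measurable_one (by fun_prop)
  obtain ⟨hi, hv⟩ := integral_gamma_sq m
  have h1 : ∫⁻ w, ENNReal.ofReal (w ^ m) * ENNReal.ofReal ((w - (m + 1)) ^ 2) ∂expMeasure 1 =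
      ENNReal.ofReal (m.factorial * (m + 1)) := by
    rw [← hv, ← lintegral_ofReal_expMeasure (fun x hx => by positivity) hi]
    refine lintegral_congr fun w => ?_
    rw [← ENNReal.ofReal_mul' (sq_nonneg _)]
  simp only [Pi.one_apply, one_mul, lintegral_const, measure_univ, mul_one] at h
  rw [h1, ENNReal.ofReal_mul (by positivity), ENNReal.ofReal_natCast, ← mul_assoc,
    ENNReal.inv_mul_cancel (by simp [Nat.factorial_ne_zero]) (by simp), one_mul] at h
  have hmk := mul_meas_ge_le_lintegral (μ := gumbelTopLaw (m + 1))
    (f := fun g : Fin (m + 1) → ℝ =>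
      ENNReal.ofReal ((Real.exp (-g (Fin.last m)) - (m + 1)) ^ 2)) (by fun_prop)
    (ENNReal.ofReal (c ^ 2))
  rw [h] at hmk
  have hset : {g : Fin (m + 1) → ℝ | c ≤ |Real.exp (-g (Fin.last m)) - (m + 1)|} ⊆
      {g | ENNReal.ofReal (c ^ 2) ≤
        ENNReal.ofReal ((Real.exp (-g (Fin.last m)) - (m + 1)) ^ 2)} := by
    intro g hg
    refine ENNReal.ofReal_le_ofReal ?_
    rw [← sq_abs (Real.exp _ - _)]
    gcongr
    exact hg
  refine (measure_mono hset).trans ?_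
  rw [ENNReal.ofReal_div_of_pos (by positivity), ENNReal.le_div_iff_mul_le
    (Or.inl (by simpa using hc.ne')) (Or.inl ENNReal.ofReal_ne_top), mul_comm]
  exact hmk

end Spacings

/-! ### Normal limit under the limit law. -/

section Limit

variable {Ω : ℕ → Type*} [∀ m, MeasurableSpace (Ω m)] {P : (m : ℕ) → Measure (Ω m)}
  {G : (m : ℕ) → Ω m → Fin (m + 1) → ℝ}

theorem tendsto_charFun_excessSum (hG : ∀ m, HasLaw (G m) (gumbelTopLaw (m + 1)) (P m)) (θ : ℝ) :
    Tendsto (fun m => charFun ((P m).map fun ω => (√(m : ℝ))⁻¹ * (excessSum m (G m ω) - m)) θ) atTop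
      (𝓝 (Complex.exp (-θ ^ 2 / 2))) := by
  have hlim : Tendsto (fun m : ℕ => expCharFun ((√(m : ℝ))⁻¹ * θ) ^ m) atTop
      (𝓝 (Complex.exp (-θ ^ 2 / 2))) :=
    tendsto_charFun_inv_sqrt_mul_pow (P := expMeasure 1) (X := fun x => x - 1) (by fun_prop)
      integral_sub_one_expMeasure integral_sub_one_sq_expMeasure θ
  refine hlim.congr fun m => ?_
  have hS : (P m).map (fun ω => excessSum m (G m ω)) = expSumLaw m := by
    rw [← map_excessSum_gumbelTopLaw, ← (hG m).map_eq,
      AEMeasurable.map_map_of_aemeasurable (measurable_excessSum m).aemeasurable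
        (hG m).aemeasurable]
    rfl
  have hSm : AEMeasurable (fun ω => excessSum m (G m ω)) (P m) :=
    (measurable_excessSum m).comp_aemeasurable (hG m).aemeasurable
  have hshift : (P m).map (fun ω => excessSum m (G m ω) - m) =
      (expSumLaw m).map fun x => x + -(m : ℝ) := by
    rw [← hS, AEMeasurable.map_map_of_aemeasurable (by fun_prop) hSm]
    rfl
  rw [charFun_map_mul_comp (hSm.sub_const _), hshift, charFun_map_add_const, charFun_expSumLaw]
  have hexp : ∀ u : ℝ, expCharFun u = charFun (expMeasure 1) u * Complex.exp (inner ℝ (-1 : ℝ) u *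
      Complex.I) := fun u => charFun_map_add_const (-1 : ℝ) u
  rw [hexp, mul_pow, ← Complex.exp_nat_mul]
  congr 2
  simp
  ring

variable [∀ m, IsProbabilityMeasure (P m)]

theorem boundedInProbability_gumbel_last
    (hG : ∀ m, HasLaw (G m) (gumbelTopLaw (m + 1)) (P m)) :
    BoundedInProbability P fun m ω =>
      √(m : ℝ) * (G m ω (Fin.last m) + Real.log ((m : ℝ) + 1)) := by
  intro η hη
  refine ⟨√(4 / η), by positivity, ?_⟩
  set K := √(4 / η) with hK
  have hK0 : 0 < K := by positivity
  have hs : Tendsto (fun m : ℕ => √(m : ℝ)) atTop atTop :=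
    Real.tendsto_sqrt_atTop.comp tendsto_natCast_atTop_atTop
  filter_upwards [hs.eventually_ge_atTop K, eventually_gt_atTop 0] with m hmK hm
  have hm' : (0:ℝ) < m := by exact_mod_cast hm
  obtain ⟨r, hr0, hr⟩ : ∃ r : ℝ, 0 < r ∧ √(m : ℝ) = r := ⟨_, Real.sqrt_pos.2 hm', rfl⟩
  have hr2 : (m : ℝ) = r ^ 2 := by rw [← hr, Real.sq_sqrt hm'.le]
  rw [hr] at hmK
  -- A deviation `|v| ≥ K / r` of `g_last + log (m + 1)` forces `|e^{-v} - 1| ≥ K / (r + K)`.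
  -- Chebyshev then gives at most `4 / K² = η`, because `K ≤ r`.
  set c : ℝ := ((m : ℝ) + 1) * (K / (r + K)) with hc
  have hc0 : 0 < c := by positivity
  have hsub : {ω | K ≤ |√(m : ℝ) * (G m ω (Fin.last m) + Real.log ((m : ℝ) + 1))|} ⊆
      {ω | c ≤ |Real.exp (-(G m ω) (Fin.last m)) - (m + 1)|} := by
    intro ω hω
    rw [Set.mem_ofPred_eq, abs_mul, hr, abs_of_pos hr0, mul_comm, ← div_le_iff₀ hr0] at hω
    rw [Set.mem_ofPred_eq]
    set v := G m ω (Fin.last m) + Real.log ((m : ℝ) + 1) with hv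
    have e : Real.exp (-(G m ω) (Fin.last m)) = (m + 1) * Real.exp (-v) := by
      rw [hv, neg_add, Real.exp_add, Real.exp_neg (Real.log _), Real.exp_log (by positivity)]
      field_simp
    rw [e, show ((m : ℝ) + 1) * Real.exp (-v) - (m + 1) = (m + 1) * (Real.exp (-v) - 1) by ring,
      abs_mul, abs_of_pos (show (0:ℝ) < m + 1 by positivity), hc]
    gcongr
    rcases le_abs.1 hω with h | h
    · have h1 : Real.exp (-v) ≤ Real.exp (-(K / r)) := Real.exp_le_exp.2 (by linarith)
      have h2 : Real.exp (-(K / r)) ≤ r / (r + K) := by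
        rw [Real.exp_neg, inv_le_comm₀ (Real.exp_pos _) (by positivity), inv_div]
        refine le_trans (le_of_eq ?_) (Real.add_one_le_exp (K / r))
        field_simp
        ring
      have h3 : K / (r + K) = 1 - r / (r + K) := by field_simp; ring
      rw [h3]
      refine le_trans ?_ (neg_le_abs _)
      linarith
    · have h1 := Real.add_one_le_exp (-v)
      have h3 : K / (r + K) ≤ K / r := by gcongr; linarith
      refine le_trans ?_ (le_abs_self _)
      linarith
  refine (measureReal_mono hsub).trans ?_
  have hmeas : MeasurableSet {g : Fin (m + 1) → ℝ |
      c ≤ |Real.exp (-g (Fin.last m)) - (m + 1)|} :=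
    measurableSet_le measurable_const (by fun_prop)
  have hle := gumbelTopLaw_exp_neg_last_le m hc0
  rw [← (hG m).map_eq, Measure.map_apply_of_aemeasurable (hG m).aemeasurable hmeas] at hle
  have hreal := ENNReal.toReal_mono ENNReal.ofReal_ne_top hle
  rw [ENNReal.toReal_ofReal (by positivity)] at hreal
  refine le_trans hreal ?_
  have hK2 : K ^ 2 = 4 / η := Real.sq_sqrt (by positivity)
  have h4 : η = 4 / K ^ 2 := by rw [hK2]; field_simp
  rw [hc, hr2, h4, mul_pow, div_pow, div_le_div_iff₀ (by positivity) (by positivity)]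
  have h5 : (r + K) ^ 2 ≤ 4 * r ^ 2 := by nlinarith
  rw [show (r ^ 2 + 1) * K ^ 2 = K ^ 2 * (r ^ 2 + 1) by ring,
    show 4 * ((r ^ 2 + 1) ^ 2 * (K ^ 2 / (r + K) ^ 2)) =
      K ^ 2 * (r ^ 2 + 1) * (4 * (r ^ 2 + 1) / (r + K) ^ 2) by field_simp]
  refine le_mul_of_one_le_right (by positivity) ?_
  rw [one_le_div (by positivity)]
  linarith

/-- The statistic differs from the standardized excess sum by `√m (g_last + log (m + 1)) / zetaGap`
plus the deterministic `√m (zetaGap - log (m + 1)) / zetaGap`, and both vanish. -/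
theorem tendstoInDistribution_omegaStat_succ
    (hG : ∀ m, HasLaw (G m) (gumbelTopLaw (m + 1)) (P m)) :
    TendstoInDistribution (fun m ω => omegaStat (m + 1) (G m ω) / omegaScale (m + 1)) atTop
      id P (gaussianReal 0 1) := by
  have hk : Tendsto (fun m : ℕ => m + 1) atTop atTop := tendsto_add_atTop_nat 1
  have hz := tendsto_zetaGap hk
  have hs : Tendsto (fun m : ℕ => √(m : ℝ)) atTop atTop :=
    Real.tendsto_sqrt_atTop.comp tendsto_natCast_atTop_atTop
  refine tendstoInDistribution_gaussian_of_charFun P _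
    (fun m ω => (√(m : ℝ))⁻¹ * (excessSum m (G m ω) - m)) (fun m => ?_) (fun m => ?_) ?_
    (tendsto_charFun_excessSum hG)
  · exact ((measurable_omegaStat _).comp_aemeasurable (hG m).aemeasurable).div_const _
  · exact (((measurable_excessSum m).comp_aemeasurable (hG m).aemeasurable).sub_const _).const_mul _
  have h1 := (vanishesInProbability_const (P := P) (tendsto_inv_atTop_zero.comp hz)).mul
    (boundedInProbability_gumbel_last hG)
  have hc : Tendsto (fun m : ℕ => √(m : ℝ) / zetaGap (m + 1) *
      (zetaGap (m + 1) - Real.log ((m : ℝ) + 1))) atTop (𝓝 0) := by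
    have hlim : Tendsto (fun m : ℕ => 1 / √(m : ℝ)) atTop (𝓝 0) := tendsto_const_nhds.div_atTop hs
    refine squeeze_zero_norm' ?_ hlim
    filter_upwards [hz.eventually_ge_atTop 1, eventually_gt_atTop 0] with m h2 hm
    have hm' : (0:ℝ) < m := by exact_mod_cast hm
    have hr0 := Real.sqrt_pos.2 hm'
    have h3 := abs_zetaGap_sub_log_le (k := m + 1) (by omega)
    push_cast at h3
    rw [add_sub_cancel_right] at h3
    rw [Real.norm_eq_abs, abs_mul, abs_div, abs_of_pos hr0,
      abs_of_pos (show 0 < zetaGap (m + 1) by linarith)]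
    calc √(m : ℝ) / zetaGap (m + 1) * |zetaGap (m + 1) - Real.log ((m : ℝ) + 1)|
        ≤ √(m : ℝ) / 1 * (1 / m) := by gcongr
      _ = 1 / √(m : ℝ) := by
        rw [div_one, mul_one_div, div_eq_div_iff hm'.ne' hr0.ne', one_mul,
          Real.mul_self_sqrt hm'.le]
  refine (h1.add (vanishesInProbability_const (P := P) hc)).of_le ?_
  filter_upwards [hz.eventually_gt_atTop 0, eventually_gt_atTop 0] with m hz0 hm
  intro ω
  have hm' : (0:ℝ) < m := by exact_mod_cast hm
  have hr0 := Real.sqrt_pos.2 hm'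
  refine le_of_eq (congrArg _ ?_)
  simp only [Function.comp]
  rw [omegaStat_succ (by omega), omegaScale, excessSum]
  push_cast
  rw [add_sub_cancel_right]
  obtain ⟨r, hr0, hr⟩ : ∃ r : ℝ, 0 < r ∧ √(m : ℝ) = r := ⟨_, Real.sqrt_pos.2 hm', rfl⟩
  have hr2 : (m : ℝ) = r ^ 2 := by rw [← hr, Real.sq_sqrt hm'.le]
  rw [hr]
  generalize Real.log ((m : ℝ) + 1) = l
  rw [hr2]
  field_simp
  ring

end Limit

theorem tendstoInDistribution_omegaStat_gumbelTopLaw {Ω : ℕ → Type*} [∀ k, MeasurableSpace (Ω k)]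
    (P : (k : ℕ) → Measure (Ω k)) [∀ k, IsProbabilityMeasure (P k)]
    (G : (k : ℕ) → Ω k → Fin k → ℝ) (hG : ∀ k, HasLaw (G k) (gumbelTopLaw k) (P k)) :
    TendstoInDistribution (fun k ω => omegaStat k (G k ω) / omegaScale k) atTop
      id P (gaussianReal 0 1) := by
  have h := tendstoInDistribution_omegaStat_succ (P := fun m => P (m + 1))
    (G := fun m => G (m + 1)) fun m => hG (m + 1)
  refine ⟨fun k => ((measurable_omegaStat k).comp_aemeasurable (hG k).aemeasurable).div_const _,
    aemeasurable_id, (tendsto_add_atTop_iff_nat 1).1 h.tendsto⟩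

theorem proposition3
    {Ω : Type*} [MeasurableSpace Ω] (P : Measure Ω) [IsProbabilityMeasure P]
    (Y : ℕ → Ω → ℝ) (μ : Measure ℝ) [IsProbabilityMeasure μ] (ρ : ℝ)
    (hμ : IsLogExpPowerLaw μ ρ)
    (hlaw : ∀ i, HasLaw (Y i) μ P) (hindep : iIndepFun Y P)
    {Ω' : ℕ → Type*} [∀ k, MeasurableSpace (Ω' k)] (P' : (k : ℕ) → Measure (Ω' k))
    [∀ k, IsProbabilityMeasure (P' k)] (G : (k : ℕ) → Ω' k → Fin k → ℝ)
    (hG : ∀ k, HasLaw (G k) (gumbelTopLaw k) (P' k)) :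
    -- `Ω_k` applied to a vector with law exactly `Λ^(k)`, as `k → ∞`
    TendstoInDistribution (fun k ω => omegaStat k (G k ω) / omegaScale k) atTop
      id P' (gaussianReal 0 1) ∧
    -- `Ω_k` applied to the sample, along every intermediate sequence
    (∀ k : ℕ → ℕ, Tendsto k atTop atTop →
      Tendsto (fun n => (k n : ℝ) / (n : ℝ)) atTop (𝓝 0) →
      ∃ c : ℕ → ℝ, TendstoInDistribution
        (fun n ω => (omegaSample Y n (k n) ω - c n) /
          (gumbelScale μ ((n : ℝ) / (k n : ℝ)) * omegaScale (k n))) atTop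
        id (fun _ => P) (gaussianReal 0 1)) ∧
    -- `Ω_k` centred at the quantile it estimates, along every slow enough sequence
    (∃ κ : ℕ → ℕ, Tendsto κ atTop atTop ∧
      Tendsto (fun n => (κ n : ℝ) / (n : ℝ)) atTop (𝓝 0) ∧
      ∀ k : ℕ → ℕ, Tendsto k atTop atTop → (∀ᶠ n in atTop, k n ≤ κ n) →
        TendstoInDistribution
          (fun n ω => (omegaSample Y n (k n) ω - quantile μ (1 - 1 / (n : ℝ))) /
            (gumbelScale μ (n : ℝ) * omegaScale (k n))) atTop
          id (fun _ => P) (gaussianReal 0 1)) := by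
  exact ⟨tendstoInDistribution_omegaStat_gumbelTopLaw P' G hG,
    fun _ hk hkn => hμ.omegaSample_intermediate hlaw hindep hk hkn,
    hμ.omegaSample_slow hlaw hindep⟩
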